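/- **Theorem 1.** Let $N,L\ge 0$ and $p+q=N+L$, and let $E=\mathbb R^{p,q}$ be the pseudo-Euclidean space of signature $(p,q)$ with scalar product $(\cdot,\cdot)$. A (parametrized, totally nonisotropic) *torsionless submanifold* on an open set $U\subset\mathbb R^N$ is a $C^\infty$ map $r:U\to E$, together with $C^\infty$ normal fields $n_1,\dots,n_L:U\to E$, such that $r_{u^1},\dots,r_{u^N},n_1,\dots,n_L$ is a basis of $E$ at each point, the first fundamental form $g_{ij}=(r_{u^i},r_{u^j})$ is nondegenerate, $(n_\alpha,r_{u^i})=0$, the Gram matrix $(n_\alpha,n_\beta)=\mu_{\alpha\beta}$ is constant, and the torsion vanishes: $(n_{\alpha,u^i},n_\beta)=0$. It is *flat* if the Riemann curvature tensor of $g$ vanishes. Its second fundamental forms are $\omega_{\alpha,ij}=(n_\alpha,r_{u^iu^j})$. (a) (*Flat coordinates.*) For each flat torsionless submanifold and each point $u_0\in U$ there is a $C^\infty$ change of coordinates from a simply connected domain onto a neighbourhood of $u_0$ in $U$, after which the first fundamental form is a constant matrix $\eta_{ij}$ (and the submanifold is still flat and torsionless, with the same Gram matrix $\mu$). (b) (*From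 submanifolds to solutions.*) Let $U$ be a simply connected open set and let $(r,n)$ be a flat torsionless submanifold on $U$ in flat coordinates, i.e. with constant first fundamental form $\mathbf I=\eta_{ij}\,du^idu^j$. Then $\eta$ and $\mu$ are symmetric and nondegenerate, the signature $(p,q)$ of $E$ is the sum of the signatures of $\eta$ and $\mu$, and there are $C^\infty$ functions $\psi_1,\dots,\psi_L$ on $U$ such that the second fundamental forms are their Hessians, $$\mathbf{II}_\alpha=\frac{\partial^2\psi_\alpha}{\partial u^i\partial u^j}\,du^idu^j,$$ and that satisfy the Gauss equations, for all $i,j,k,l$, $$\sum_{\alpha,\beta=1}^L\mu^{\alpha\beta}\left(\frac{\partial^2\psi_\alpha}{\partial u^i\partial u^k}\frac{\partial^2\psi_\beta}{\partial u^j\partial u^l}-\frac{\partial^2\psi_\alpha}{\partial u^i\partial u^l}\frac{\partial^2\psi_\beta}{\partial u^j\partial u^k}\right)=0\qquad(\mathrm{g3})$$ and the Ricci equations, for all $\alpha,\beta,k,l$, $$\sum_{i,j=1}^N\eta^{ij}\left(\frac{\partial^2\psi_\alpha}{\partial u^i\partial u^k}\frac{\partial^2\psi_\beta}{\partial u^j\partial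 u^l}-\frac{\partial^2\psi_\alpha}{\partial u^i\partial u^l}\frac{\partial^2\psi_\beta}{\partial u^j\partial u^k}\right)=0,\qquad(\mathrm{r3})$$ where $(\eta^{ij})$ and $(\mu^{\alpha\beta})$ are the inverses of $(\eta_{ij})$ and $(\mu_{\alpha\beta})$. The solutions with these Hessians are exactly the families that differ from $(\psi_\alpha)$ by affine functions $a_{\alpha i}u^i+c_\alpha$. (c) (*From solutions to submanifolds.*) Conversely, let $\eta$ ($N\times N$) and $\mu$ ($L\times L$) be arbitrary constant nondegenerate symmetric matrices whose signatures add up to $(p,q)$, let $U\subset\mathbb R^N$ be open and simply connected, and let $\psi_1,\dots,\psi_L$ be a $C^\infty$ solution of (g3), (r3) on $U$. Then there is a flat torsionless submanifold $(r,n)$ on $U$ in $E$ with $(n_\alpha,n_\beta)=\mu_{\alpha\beta}$, first fundamental form $\eta_{ij}\,du^idu^j$ and second fundamental forms the Hessians of the $\psi_\alpha$. It is unique up to motions of $E$: any other such $(r',n')$ is $r'=Tr+c$, $n'_\alpha=Tn_\alpha$ on $U$ for some linear isometry $T$ of $E$ and some $c\in E$. -/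

import Mathlib

open scoped ContDiff

namespace Submfd

noncomputable section

/-- The underlying vector space of the pseudo-Euclidean space of signature `(p, q)`. -/
abbrev PseudoE (p q : ℕ) : Type := Fin p ⊕ Fin q → ℝ

/-- The scalar product of signature `(p, q)`:
`(x, y) = x₁y₁ + ⋯ + x_p y_p - x_{p+1}y_{p+1} - ⋯ - x_{p+q}y_{p+q}`. -/
def pseudoInner {p q : ℕ} (x y : PseudoE p q) : ℝ :=
  ∑ a : Fin p, x (Sum.inl a) * y (Sum.inl a) - ∑ b : Fin q, x (Sum.inr b) * y (Sum.inr b)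

/-- The partial derivative `∂f/∂uⁱ` at the point `u`. -/
def pd {N : ℕ} {E : Type} [NormedAddCommGroup E] [NormedSpace ℝ E]
    (i : Fin N) (f : (Fin N → ℝ) → E) (u : Fin N → ℝ) : E :=
  fderiv ℝ f u (Pi.single i 1)

/-- The first fundamental form `g_{ij} = (r_{uⁱ}, r_{uʲ})`. -/
def firstForm {N p q : ℕ} (r : (Fin N → ℝ) → PseudoE p q) (u : Fin N → ℝ) :
    Matrix (Fin N) (Fin N) ℝ :=
  Matrix.of fun i j => pseudoInner (pd i r u) (pd j r u)

/-- The second fundamental form `ω_{ij} = (m, r_{uⁱuʲ})` belonging to one normal field `m`. -/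
def secondForm {N p q : ℕ} (r m : (Fin N → ℝ) → PseudoE p q) (u : Fin N → ℝ) :
    Matrix (Fin N) (Fin N) ℝ :=
  Matrix.of fun i j => pseudoInner (m u) (pd j (pd i r) u)

/-- The coefficient of torsion `(n_{α,uⁱ}, n_β)` (with the normal index `β` lowered). -/
def torsion {N L p q : ℕ} (n : Fin L → (Fin N → ℝ) → PseudoE p q)
    (α β : Fin L) (i : Fin N) (u : Fin N → ℝ) : ℝ :=
  pseudoInner (pd i (n α) u) (n β u)

/-- The Hessian matrix `∂²ψ/∂uⁱ∂uʲ`. -/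
def hessian {N : ℕ} (ψ : (Fin N → ℝ) → ℝ) (u : Fin N → ℝ) : Matrix (Fin N) (Fin N) ℝ :=
  Matrix.of fun i j => pd j (pd i ψ) u

/-- The Christoffel symbol `Γᵏ_{ij}` of the Levi-Civita connection of the metric `g`. -/
def christoffel {N : ℕ} (g : (Fin N → ℝ) → Matrix (Fin N) (Fin N) ℝ) (k i j : Fin N)
    (u : Fin N → ℝ) : ℝ :=
  (1 / 2 : ℝ) * ∑ s, (g u)⁻¹ k s *
    (pd i (fun v => g v j s) u + pd j (fun v => g v i s) u - pd s (fun v => g v i j) u)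

/-- The component `Rˡ_{kij}` of the Riemann curvature tensor of the metric `g`. -/
def riemann {N : ℕ} (g : (Fin N → ℝ) → Matrix (Fin N) (Fin N) ℝ) (l k i j : Fin N)
    (u : Fin N → ℝ) : ℝ :=
  pd i (christoffel g l j k) u - pd j (christoffel g l i k) u
    + ∑ m, (christoffel g l i m u * christoffel g m j k u
      - christoffel g l j m u * christoffel g m i k u)

/-- `r : U → ℝ^{p,q}` is a parametrized flat torsionless totally nonisotropic smooth submanifold,
and `n` is a smooth frame of its normal spaces with constant Gram matrix `μ` and zero torsion
(a basis of the normal spaces when `p + q = N + L`). -/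
structure IsFlatTorsionless {N L p q : ℕ} (U : Set (Fin N → ℝ)) (μ : Matrix (Fin L) (Fin L) ℝ)
    (r : (Fin N → ℝ) → PseudoE p q) (n : Fin L → (Fin N → ℝ) → PseudoE p q) : Prop where
  smooth_r : ContDiffOn ℝ ∞ r U
  smooth_n : ∀ α, ContDiffOn ℝ ∞ (n α) U
  /-- the tangent vectors `r_{uⁱ}` and the normals `n_α` are linearly independent -/
  linearIndependent : ∀ u ∈ U, LinearIndependent ℝ
    (Sum.elim (fun i : Fin N => pd i r u) (fun α : Fin L => n α u))
  nonisotropic : ∀ u ∈ U, (firstForm r u).det ≠ 0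
  normal : ∀ u ∈ U, ∀ α i, pseudoInner (n α u) (pd i r u) = 0
  gram : ∀ u ∈ U, ∀ α β, pseudoInner (n α u) (n β u) = μ α β
  torsionless : ∀ u ∈ U, ∀ α β i, torsion n α β i u = 0
  flat : ∀ u ∈ U, ∀ l k i j, riemann (firstForm r) l k i j u = 0

/-- `(r, n)` is a flat torsionless submanifold with normal frame of Gram matrix `μ`, referred to
flat coordinates in which the first fundamental form is the constant matrix `η`. -/
def IsFlatTorsionlessIn {N L p q : ℕ} (U : Set (Fin N → ℝ)) (η : Matrix (Fin N) (Fin N) ℝ)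
    (μ : Matrix (Fin L) (Fin L) ℝ) (r : (Fin N → ℝ) → PseudoE p q)
    (n : Fin L → (Fin N → ℝ) → PseudoE p q) : Prop :=
  IsFlatTorsionless U μ r n ∧ ∀ u ∈ U, firstForm r u = η

/-- The second fundamental forms of `(r, n)` on `U` are the Hessians of the functions `ψ_α`. -/
def HasHessianForms {N L p q : ℕ} (U : Set (Fin N → ℝ)) (r : (Fin N → ℝ) → PseudoE p q)
    (n : Fin L → (Fin N → ℝ) → PseudoE p q) (ψ : Fin L → (Fin N → ℝ) → ℝ) : Prop :=
  ∀ u ∈ U, ∀ α, secondForm r (n α) u = hessian (ψ α) u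

/-- The Gauss equations in flat coordinates. -/
def GaussEqs {N L : ℕ} (U : Set (Fin N → ℝ)) (μ : Matrix (Fin L) (Fin L) ℝ)
    (ψ : Fin L → (Fin N → ℝ) → ℝ) : Prop :=
  ∀ u ∈ U, ∀ i j k l : Fin N, ∑ α, ∑ β, μ⁻¹ α β *
    (hessian (ψ α) u i k * hessian (ψ β) u j l - hessian (ψ α) u i l * hessian (ψ β) u j k) = 0

/-- The Ricci equations in flat coordinates. -/
def RicciEqs {N L : ℕ} (U : Set (Fin N → ℝ)) (η : Matrix (Fin N) (Fin N) ℝ)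
    (ψ : Fin L → (Fin N → ℝ) → ℝ) : Prop :=
  ∀ u ∈ U, ∀ (α β : Fin L) (k l : Fin N), ∑ i, ∑ j, η⁻¹ i j *
    (hessian (ψ α) u i k * hessian (ψ β) u j l - hessian (ψ α) u i l * hessian (ψ β) u j k) = 0

/-- A smooth solution `ψ_1, …, ψ_L` on `U` of the Gauss and Ricci equations. -/
def IsSolution {N L : ℕ} (U : Set (Fin N → ℝ)) (η : Matrix (Fin N) (Fin N) ℝ)
    (μ : Matrix (Fin L) (Fin L) ℝ) (ψ : Fin L → (Fin N → ℝ) → ℝ) : Prop :=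
  (∀ α, ContDiffOn ℝ ∞ (ψ α) U) ∧ GaussEqs U μ ψ ∧ RicciEqs U η ψ

/-- A constant nondegenerate symmetric matrix. -/
def IsMetric {k : ℕ} (A : Matrix (Fin k) (Fin k) ℝ) : Prop := A.IsSymm ∧ A.det ≠ 0

/-- The signature `(p, q)` is the sum of the signatures of `η` and `μ`. -/
def SignatureSum {N L : ℕ} (p q : ℕ) (η : Matrix (Fin N) (Fin N) ℝ)
    (μ : Matrix (Fin L) (Fin L) ℝ) : Prop :=
  p = sigPos η.toQuadraticForm' + sigPos μ.toQuadraticForm' ∧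
    q = sigNeg η.toQuadraticForm' + sigNeg μ.toQuadraticForm'

/-- Some motion `z ↦ T z + c` of `ℝ^{p,q}` (`T` preserves the scalar product) carries `(r, n)`
to `(r', n')`. -/
def Congruent {N L p q : ℕ} (U : Set (Fin N → ℝ)) (r r' : (Fin N → ℝ) → PseudoE p q)
    (n n' : Fin L → (Fin N → ℝ) → PseudoE p q) : Prop :=
  ∃ (T : PseudoE p q ≃ₗ[ℝ] PseudoE p q) (c : PseudoE p q),
    (∀ x y, pseudoInner (T x) (T y) = pseudoInner x y) ∧
    ∀ u ∈ U, r' u = T (r u) + c ∧ ∀ α, n' α u = T (n α u)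

end

end Submfd

/-! Everything rests on one Frobenius theorem: a linear total system `dY = A Y` whose cross
derivatives are compatible has, on a simply connected open set, a smooth solution with any initial
value (`exists_linear_system_solution`), and on a connected open set only one
(`linear_system_solution_unique`). Locally the solution is built by integrating along segments from
a point, and compatibility makes it differentiable with the right derivative. Globally, linearity
gives all solutions a common ball of existence, so the graphs of local solutions form a covering of
`U`, and a section comes from lifting the inclusion of `U`.

In flat coordinates the Christoffel symbols vanish, so `r_{ij}` is normal; zero torsion makes
`n_{α,k}` tangent. Hence the frame `(r_{uⁱ}, n_α)` solves a linear system with coefficients built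
from `η`, `μ` and the second fundamental forms. Equality of mixed derivatives yields the Codazzi,
Gauss and Ricci equations (`codazzi`, `gauss`, `ricci`). Codazzi and the symmetry of `ω` allow two
uses of the Poincaré lemma, which turn `ω_α` into a Hessian.

Conversely, Hessians satisfy Codazzi automatically, and Gauss and Ricci are the rest of the
compatibility conditions (`frameCoeff_compat`). A frame with Gram matrix `diag(η, μ)` at one point
exists by Sylvester's law (`exists_isFrame`). It extends to a solution whose Gram matrix stays
constant, because the constant matrix solves the same induced system. The tangent part of the frame
is closed and integrates to `r`. Congruence is uniqueness for the frame system.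

Flat coordinates come from the same theorem: zero curvature is the integrability of the system for a
parallel coframe, which is closed since the connection is symmetric (`exists_flat_map`). -/

namespace Submfd

open Set Metric Filter Topology

/-! ### Uniqueness and regularity for `dY = A Y`. -/

section TotalSystem

variable {E V : Type*} [NormedAddCommGroup E] [NormedSpace ℝ E]
  [NormedAddCommGroup V] [NormedSpace ℝ V]

/-- `Y` satisfies the total linear system `dY = A Y` at the point `u`. -/
def SolvesAt (A : E → E →L[ℝ] V →L[ℝ] V) (Y : E → V) (u : E) : Prop :=
  HasFDerivAt Y ((ContinuousLinearMap.apply ℝ V (Y u)).comp (A u)) u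

/-- The system `dY = A Y` is completely integrable at the point `u`. -/
def IntegrableAt (A : E → E →L[ℝ] V →L[ℝ] V) (u : E) : Prop :=
  ∀ x y : E, fderiv ℝ A u x y + (A u y).comp (A u x) = fderiv ℝ A u y x + (A u x).comp (A u y)

/-- The bound `1 / 2` lets one Picard–Lindelöf step cover all of `[0, 1]`: on the ball of radius
`‖v‖ + 1` about `v` the field has norm at most `(2‖v‖ + 1) / 2`, so no solution leaves the ball in
unit time. -/
theorem exists_linear_ode_solution [CompleteSpace V] {c : ℝ → V →L[ℝ] V}
    (hc : ContinuousOn c (Icc 0 1)) (hb : ∀ t ∈ Icc (0 : ℝ) 1, ‖c t‖ ≤ 1 / 2) (v : V) :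
    ∃ y : ℝ → V, y 0 = v ∧
      ∀ t ∈ Icc (0 : ℝ) 1, HasDerivWithinAt y (c t (y t)) (Icc 0 1) t := by
  have hb' : ∀ t ∈ Icc (0 : ℝ) 1, ∀ z, ‖c t z‖ ≤ 1 / 2 * ‖z‖ := fun t ht z =>
    (c t).le_of_opNorm_le (hb t ht) z
  have h : IsPicardLindelof (fun t z => c t z) (tmin := 0) (tmax := 1) ⟨0, by simp⟩ v
      (‖v‖₊ + 1) 0 (‖v‖₊ + 1) (1 / 2) := by
    refine ⟨fun t ht => ?_, fun z _ => ?_, fun t ht z hz => ?_, ?_⟩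
    · refine LipschitzWith.lipschitzOnWith ?_
      refine LipschitzWith.of_dist_le_mul fun x y => ?_
      rw [dist_eq_norm, dist_eq_norm, ← map_sub]
      simpa using hb' t ht (x - y)
    · exact hc.clm_apply continuousOn_const
    · have h1 : ‖z‖ ≤ ‖v‖ + (‖v‖ + 1) := by
        have := norm_le_norm_add_norm_sub' z v
        rw [mem_closedBall, dist_eq_norm] at hz
        push_cast at hz
        linarith
      refine (hb' t ht z).trans ?_
      push_cast
      linarith
    · simp
  obtain ⟨y, h0, hy⟩ := h.exists_eq_forall_mem_Icc_hasDerivWithinAt₀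
  exact ⟨y, h0, hy⟩

theorem SolvesAt.hasDerivWithinAt_segment {A : E → E →L[ℝ] V →L[ℝ] V} {Y : E → V} {a x : E}
    {t : ℝ} (h : SolvesAt A Y (a + t • x)) (s : Set ℝ) :
    HasDerivWithinAt (fun t : ℝ => Y (a + t • x)) (A (a + t • x) x (Y (a + t • x))) s t := by
  have h1 : HasDerivAt (fun t : ℝ => a + t • x) x t := by
    simpa using ((hasDerivAt_id t).smul_const x).const_add a
  have h2 : HasFDerivAt Y
      ((ContinuousLinearMap.apply ℝ V (Y (a + t • x))).comp (A (a + t • x))) (a + t • x) := h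
  simpa using! (h2.comp_hasDerivAt t h1).hasDerivWithinAt

/-- Two solutions on a convex set that agree at one point are equal. -/
theorem SolvesAt.eqOn_of_convex {A : E → E →L[ℝ] V →L[ℝ] V} {Y Z : E → V} {B : Set E}
    (hB : Convex ℝ B) (hA : ContinuousOn A B) (hY : ∀ u ∈ B, SolvesAt A Y u)
    (hZ : ∀ u ∈ B, SolvesAt A Z u) {a : E} (ha : a ∈ B) (haYZ : Y a = Z a) : EqOn Y Z B := by
  intro u hu
  set x := u - a with hx
  have hseg : ∀ t ∈ Icc (0 : ℝ) 1, a + t • x ∈ B := fun t ht =>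
    hB.add_smul_sub_mem ha hu ht
  have hcont : ContinuousOn (fun t : ℝ => A (a + t • x) x) (Icc 0 1) :=
    (hA.comp (by fun_prop) hseg).clm_apply continuousOn_const
  obtain ⟨K, hK⟩ := isCompact_Icc.exists_bound_of_continuousOn hcont
  have hmem : ∀ t ∈ Ico (0 : ℝ) 1, t ∈ Icc (0 : ℝ) 1 := fun t ht => ⟨ht.1, ht.2.le⟩
  -- Along the segment the difference of the solutions satisfies a linear ODE with operator norm at
  -- most `K` and starts at zero, so Gronwall's inequality kills it.
  have key := eq_zero_of_abs_deriv_le_mul_abs_self_of_eq_zero_right (a := 0) (b := 1) (K := K)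
    (f := fun t : ℝ => Y (a + t • x) - Z (a + t • x))
    (f' := fun t : ℝ => A (a + t • x) x (Y (a + t • x)) - A (a + t • x) x (Z (a + t • x)))
    (fun t ht => (((hY _ (hseg t ht)).hasDerivWithinAt_segment _).sub
      ((hZ _ (hseg t ht)).hasDerivWithinAt_segment _)).continuousWithinAt)
    (fun t ht => ((hY _ (hseg t (hmem t ht))).hasDerivWithinAt_segment _).sub
      ((hZ _ (hseg t (hmem t ht))).hasDerivWithinAt_segment _))
    (by simp [haYZ])
    (fun t ht => by
      rw [← map_sub]
      exact ContinuousLinearMap.le_of_opNorm_le _ (hK t (hmem t ht)) _) 1 (by simp)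
  have : a + (1 : ℝ) • x = u := by simp [hx]
  simp only [this] at key
  exact sub_eq_zero.1 key

/-- Two solutions near a point that agree at the point are equal near it. -/
theorem SolvesAt.eventuallyEq {A : E → E →L[ℝ] V →L[ℝ] V} {Y Z : E → V} {U : Set E}
    (hU : IsOpen U) (hA : ContinuousOn A U) {a : E} (ha : a ∈ U)
    (hY : ∀ᶠ u in 𝓝 a, SolvesAt A Y u) (hZ : ∀ᶠ u in 𝓝 a, SolvesAt A Z u) (haYZ : Y a = Z a) :
    Y =ᶠ[𝓝 a] Z := by
  obtain ⟨ρ, hρ, h⟩ := Metric.eventually_nhds_iff_ball.1 ((hY.and hZ).and (hU.mem_nhds ha))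
  filter_upwards [ball_mem_nhds a hρ] with u hu
  exact SolvesAt.eqOn_of_convex (convex_ball a ρ) (hA.mono fun w hw => (h w hw).2)
    (fun w hw => (h w hw).1.1) (fun w hw => (h w hw).1.2) (mem_ball_self hρ) haYZ hu

/-- Two solutions on a connected open set that agree at one point are equal. -/
theorem SolvesAt.eqOn_of_isPreconnected {A : E → E →L[ℝ] V →L[ℝ] V} {Y Z : E → V} {U : Set E}
    (hU : IsOpen U) (hc : IsPreconnected U) (hA : ContinuousOn A U)
    (hY : ∀ u ∈ U, SolvesAt A Y u) (hZ : ∀ u ∈ U, SolvesAt A Z u) {a : E} (ha : a ∈ U)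
    (haYZ : Y a = Z a) : EqOn Y Z U := by
  have hev : ∀ W : E → V, (∀ u ∈ U, SolvesAt A W u) → ∀ u ∈ U, ∀ᶠ w in 𝓝 u, SolvesAt A W w :=
    fun W hW u hu => eventually_of_mem (hU.mem_nhds hu) hW
  have h1 : IsOpen {u ∈ U | Y u = Z u} := by
    rw [isOpen_iff_mem_nhds]
    rintro u ⟨hu, he⟩
    filter_upwards [hU.mem_nhds hu, SolvesAt.eventuallyEq hU hA hu (hev Y hY u hu)
      (hev Z hZ u hu) he] with w hw hw' using ⟨hw, hw'⟩
  have h2 : IsOpen {u ∈ U | Y u ≠ Z u} := by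
    rw [isOpen_iff_mem_nhds]
    rintro u ⟨hu, he⟩
    have hcY : ContinuousAt Y u := (hY u hu).continuousAt
    have hcZ : ContinuousAt Z u := (hZ u hu).continuousAt
    filter_upwards [hU.mem_nhds hu, (hcY.sub hcZ).eventually_ne (sub_ne_zero.2 he)] with w hw hw'
    exact ⟨hw, sub_ne_zero.1 hw'⟩
  intro u hu
  by_contra hne
  obtain ⟨w, -, hw1, hw2⟩ := hc _ _ h1 h2 (fun w hw => by
    by_cases h : Y w = Z w
    · exact Or.inl ⟨hw, h⟩
    · exact Or.inr ⟨hw, h⟩) ⟨a, ha, ha, haYZ⟩ ⟨u, hu, hu, hne⟩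
  exact hw2.2 hw1.2

/-- Solutions of a smooth system are smooth. -/
theorem SolvesAt.contDiffOn {A : E → E →L[ℝ] V →L[ℝ] V} {Y : E → V} {U : Set E}
    (hU : IsOpen U) (hA : ContDiffOn ℝ ∞ A U) (hY : ∀ u ∈ U, SolvesAt A Y u) :
    ContDiffOn ℝ ∞ Y U := by
  rw [contDiffOn_infty]
  intro n
  -- Bootstrapping: if `Y` is `Cⁿ`, then so is `dY = A Y`, and `Y` is `Cⁿ⁺¹`.
  induction n with
  | zero =>
    exact contDiffOn_zero.2 fun u hu => (hY u hu).continuousAt.continuousWithinAt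
  | succ n ih =>
    rw [Nat.cast_add, Nat.cast_one, contDiffOn_succ_iff_fderiv_of_isOpen hU]
    refine ⟨fun u hu => (hY u hu).differentiableAt.differentiableWithinAt, by simp, ?_⟩
    have hA' : ContDiffOn ℝ n A U := contDiffOn_infty.1 hA n
    have hfl : ContDiffOn ℝ n (fun u => ContinuousLinearMap.apply ℝ V (Y u)) U :=
      contDiffOn_const.clm_apply ih
    exact (hfl.clm_comp hA').congr fun u hu => (hY u hu).fderiv

end TotalSystem

/-! ### Local existence, by integration along segments. -/

section LocalExistence

set_option maxSynthPendingDepth 6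

variable {E V : Type*} [NormedAddCommGroup E] [NormedSpace ℝ E]
  [NormedAddCommGroup V] [NormedSpace ℝ V]

/-- On a small convex open set, a completely integrable system has a solution through every
point. -/
theorem exists_solution_of_convex [CompleteSpace V] {A : E → E →L[ℝ] V →L[ℝ] V} {B : Set E}
    {M D K : ℝ} (hK : 0 ≤ K) (hMD : M * D ≤ 1 / 2)
    (hBo : IsOpen B) (hB : Convex ℝ B)
    (hdiff : ∀ w ∈ B, HasFDerivAt A (fderiv ℝ A w) w)
    (hAM : ∀ w ∈ B, ‖A w‖ ≤ M) (hA'M : ∀ w ∈ B, ‖fderiv ℝ A w‖ ≤ K)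
    (hAK : ∀ w ∈ B, ∀ w' ∈ B, ‖A w' - A w - fderiv ℝ A w (w' - w)‖ ≤ K * ‖w' - w‖ ^ 2)
    (hdiam : ∀ w ∈ B, ∀ w' ∈ B, ‖w' - w‖ ≤ D)
    (hint : ∀ w ∈ B, IntegrableAt A w) {a : E} (ha : a ∈ B) (v : V) :
    ∃ Y : E → V, Y a = v ∧ ∀ u ∈ B, SolvesAt A Y u := by
  classical
  have hseg : ∀ u ∈ B, ∀ t ∈ Icc (0 : ℝ) 1, a + t • (u - a) ∈ B := fun u hu t ht =>
    hB.add_smul_sub_mem ha hu ht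
  have hAcont : ContinuousOn A B := fun w hw => (hdiff w hw).continuousAt.continuousWithinAt
  have hop : ∀ w ∈ B, ∀ w' ∈ B, ∀ w'' ∈ B, ‖A w'' (w' - w)‖ ≤ 1 / 2 :=
    fun w hw w' hw' w'' hw'' =>
      ((A w'').le_of_opNorm_le_of_le (hAM _ hw'') (hdiam w hw w' hw')).trans hMD
  have hode : ∀ u ∈ B, ∃ y : ℝ → V, y 0 = v ∧ ∀ t ∈ Icc (0 : ℝ) 1,
      HasDerivWithinAt y (A (a + t • (u - a)) (u - a) (y t)) (Icc 0 1) t := fun u hu =>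
    exists_linear_ode_solution
      ((hAcont.comp (by fun_prop) (hseg u hu)).clm_apply continuousOn_const)
      (fun t ht => hop _ ha _ hu _ (hseg u hu t ht)) v
  choose! y hy0 hy using hode
  have hmem : ∀ t ∈ Ico (0 : ℝ) 1, t ∈ Icc (0 : ℝ) 1 := fun t ht => ⟨ht.1, ht.2.le⟩
  -- The candidate at `u` is the time-one value of the ODE along the segment from `a` to `u`. For `u
  -- = a` the ODE is trivial and the value is `v`.
  refine ⟨fun u => y u 1, ?_, fun u hu => ?_⟩
  · have h := constant_of_derivWithin_zero (f := y a) (a := 0) (b := 1)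
      (fun t ht => (hy a ha t ht).differentiableWithinAt) (fun t ht => by
        rw [(hy a ha t (hmem t ht)).derivWithin (uniqueDiffOn_Icc zero_lt_one t (hmem t ht))]
        simp) 1 (by simp)
    exact h.trans (hy0 a ha)
  · obtain ⟨C, hC⟩ := isCompact_Icc.exists_bound_of_continuousOn
      (fun t ht => (hy u hu t ht).continuousWithinAt : ContinuousOn (y u) (Icc 0 1))
    have hC0 : 0 ≤ C := (norm_nonneg _).trans (hC 0 (by simp))
    set x := u - a with hx
    set c : ℝ := (K * D + K + (M + K * D) * M) * C with hc
    -- first order expansion of the solutions along the segments issuing from `a`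
    have key : ∀ u' ∈ B, ‖y u' 1 - y u 1 - A u (u' - u) (y u 1)‖ ≤
        gronwallBound 0 (1 / 2 : NNReal) (0 + c * ‖u' - u‖ ^ 2) 1 := by
      intro u' hu'
      set h := u' - u with hh
      have hx' : u' - a = x + h := by rw [hx, hh]; abel
      have hw' : ∀ t : ℝ, a + t • (u' - a) = a + t • x + t • h := fun t => by
        rw [hx', smul_add, add_assoc]
      have hIci : ∀ t ∈ Ico (0 : ℝ) 1, Icc (0 : ℝ) 1 ∈ 𝓝[Ici t] t := fun t ht =>
        mem_of_superset (Icc_mem_nhdsGE ht.2) (Icc_subset_Icc_left ht.1)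
      -- The displacement between the two segments at time `t` is `t • h`, so `dY = A Y` predicts
      -- this first-order approximation of `y u' t`. Its derivative is computed here, to be compared
      -- with the ODE of `u'`.
      have hG : ∀ t ∈ Icc (0 : ℝ) 1, HasDerivWithinAt
          (fun t => y u t + A (a + t • x) (t • h) (y u t))
          (A (a + t • x) x (y u t) + ((fderiv ℝ A (a + t • x) x (t • h) + A (a + t • x) h) (y u t)
            + A (a + t • x) (t • h) (A (a + t • x) x (y u t)))) (Icc 0 1) t := by
        intro t ht
        have hl : HasDerivAt (fun t : ℝ => a + t • x) x t := by
          simpa using ((hasDerivAt_id t).smul_const x).const_add a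
        have hAl : HasDerivAt (fun t : ℝ => A (a + t • x)) (fderiv ℝ A (a + t • x) x) t :=
          (hdiff _ (hseg u hu t ht)).comp_hasDerivAt t hl
        have hth : HasDerivAt (fun t : ℝ => t • h) h t := by
          simpa using (hasDerivAt_id t).smul_const h
        exact (hy u hu t ht).add ((hAl.clm_apply hth).hasDerivWithinAt.clm_apply (hy u hu t ht))
      have hlip : ∀ t ∈ Ico (0 : ℝ) 1,
          LipschitzOnWith (1 / 2) (fun z => A (a + t • (u' - a)) (u' - a) z) univ := by
        intro t ht
        refine LipschitzWith.lipschitzOnWith (LipschitzWith.of_dist_le_mul fun z z' => ?_)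
        rw [dist_eq_norm, dist_eq_norm, ← map_sub]
        exact ContinuousLinearMap.le_of_opNorm_le _
          (by simpa using hop a ha u' hu' _ (hseg u' hu' t (hmem t ht))) _
      have hbound : ∀ t ∈ Ico (0 : ℝ) 1, dist
          (A (a + t • x) x (y u t) + ((fderiv ℝ A (a + t • x) x (t • h) + A (a + t • x) h) (y u t)
            + A (a + t • x) (t • h) (A (a + t • x) x (y u t))))
          (A (a + t • (u' - a)) (u' - a) (y u t + A (a + t • x) (t • h) (y u t))) ≤
            c * ‖h‖ ^ 2 := by
        intro t ht
        have ht' := hmem t ht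
        have hwB := hseg u hu t ht'
        have hwB' := hseg u' hu' t ht'
        -- Integrability exchanges `x` and `t • h`. This cancels all terms of first order in `h` in
        -- the defect of the approximate trajectory.
        have hi := congrArg (fun T : V →L[ℝ] V => T (y u t)) (hint _ hwB x (t • h))
        simp only [add_apply, ContinuousLinearMap.comp_apply] at hi
        have hsub : a + t • (u' - a) - (a + t • x) = t • h := by rw [hw']; abel
        have hrem := hAK _ hwB _ hwB'
        have hlipA : ‖A (a + t • (u' - a)) - A (a + t • x)‖ ≤
            K * ‖a + t • (u' - a) - (a + t • x)‖ :=
          Convex.norm_image_sub_le_of_norm_hasFDerivWithin_le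
            (fun w hw => (hdiff w hw).hasFDerivWithinAt) hA'M hB hwB hwB'
        rw [hsub] at hrem hlipA
        have hxh : ‖x + h‖ ≤ D := hx' ▸ hdiam a ha u' hu'
        have hth : ‖t • h‖ ≤ ‖h‖ := by
          rw [norm_smul, Real.norm_of_nonneg ht.1]
          exact mul_le_of_le_one_left (norm_nonneg _) ht.2.le
        have hyC := hC t ht'
        rw [hx'] at hrem hlipA ⊢
        set w := a + t • x with hw
        set w' := a + t • (x + h) with hw'def
        set z := y u t with hz
        set P := A w' - A w - fderiv ℝ A w (t • h) with hP
        set Q := A w' - A w with hQ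
        have e1 : ‖P (x + h) z‖ ≤ K * ‖h‖ ^ 2 * D * C :=
          (P (x + h)).le_of_opNorm_le_of_le (P.le_of_opNorm_le_of_le
            (hrem.trans (by gcongr)) hxh) hyC
        have e2 : ‖fderiv ℝ A w (t • h) h z‖ ≤ K * ‖h‖ * ‖h‖ * C :=
          (fderiv ℝ A w (t • h) h).le_of_opNorm_le_of_le
            ((fderiv ℝ A w (t • h)).le_of_opNorm_le_of_le
              ((fderiv ℝ A w).le_of_opNorm_le_of_le (hA'M _ hwB) hth) le_rfl) hyC
        have e3 : ‖A w (t • h) z‖ ≤ M * ‖h‖ * C :=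
          (A w (t • h)).le_of_opNorm_le_of_le ((A w).le_of_opNorm_le_of_le (hAM _ hwB) hth) hyC
        have e4 : ‖Q (x + h) (A w (t • h) z)‖ ≤ K * ‖h‖ * D * (M * ‖h‖ * C) :=
          (Q (x + h)).le_of_opNorm_le_of_le (Q.le_of_opNorm_le_of_le
            (hlipA.trans (by gcongr)) hxh) e3
        have e5 : ‖A w h (A w (t • h) z)‖ ≤ M * ‖h‖ * (M * ‖h‖ * C) :=
          (A w h).le_of_opNorm_le_of_le ((A w).le_of_opNorm_le_of_le (hAM _ hwB) le_rfl) e3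
        -- What remains is quadratic in `h`: `P` is a second-order Taylor remainder, and each other
        -- term has two factors of first order.
        have hsplit : A w x z + ((fderiv ℝ A w x (t • h) + A w h) z + A w (t • h) (A w x z)) -
            A w' (x + h) (z + A w (t • h) z) =
            -(P (x + h) z) - fderiv ℝ A w (t • h) h z - Q (x + h) (A w (t • h) z)
              - A w h (A w (t • h) z) := by
          have hi' : fderiv ℝ A w x (t • h) z + A w (t • h) (A w x z) =
            fderiv ℝ A w (t • h) x z + A w x (A w (t • h) z) := hi
          rw [add_apply]
          have : A w x z + (fderiv ℝ A w x (t • h) z + A w h z + A w (t • h) (A w x z)) =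
            A w x z + A w h z + (fderiv ℝ A w (t • h) x z + A w x (A w (t • h) z)) := by
              rw [← hi']; abel
          rw [this, hP, hQ]
          simp only [map_add, sub_apply, add_apply]
          abel
        rw [dist_eq_norm, hsplit]
        refine (norm_sub_le_of_le (norm_sub_le_of_le (norm_sub_le_of_le
          ((norm_neg _).le.trans e1) e2) e4) e5).trans (le_of_eq ?_)
        rw [hc]; ring
      -- Both trajectories start at `v`; one is exact and the other has defect at most `c * ‖h‖ ^
      -- 2`, so at time one they differ by `O(‖h‖ ^ 2)`.
      have := dist_le_of_approx_trajectories_ODE_of_mem (a := 0) (b := 1) (δ := 0)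
        (s := fun _ => univ) (K := 1 / 2) (v := fun t z => A (a + t • (u' - a)) (u' - a) z)
        (f := y u') (f' := fun t => A (a + t • (u' - a)) (u' - a) (y u' t)) (εf := 0)
        (g := fun t => y u t + A (a + t • x) (t • h) (y u t)) hlip
        (fun t ht => (hy u' hu' t ht).continuousWithinAt)
        (fun t ht => (hy u' hu' t (hmem t ht)).mono_of_mem_nhdsWithin (hIci t ht))
        (fun t _ => (dist_self _).le) (fun _ _ => mem_univ _)
        (fun t ht => (hG t ht).continuousWithinAt)
        (fun t ht => (hG t (hmem t ht)).mono_of_mem_nhdsWithin (hIci t ht)) hbound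
        (fun _ _ => mem_univ _) (by simp [hy0 u hu, hy0 u' hu']) 1 (by simp)
      rw [dist_eq_norm, one_smul, one_smul, sub_zero, hx, add_sub_cancel] at this
      rwa [sub_sub]
    refine HasFDerivAt.of_isLittleO ?_
    have hlo : (fun u' => ‖u' - u‖ ^ 2) =o[𝓝 u] fun u' => u' - u := by
      have ht : Tendsto (fun u' => u' - u) (𝓝 u) (𝓝 0) := by
        have : ContinuousAt (fun u' => u' - u) u := by fun_prop
        simpa [ContinuousAt] using this
      exact (Asymptotics.isLittleO_norm_pow_id (E' := E) one_lt_two).comp_tendsto ht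
    refine Asymptotics.IsBigO.trans_isLittleO (Asymptotics.IsBigO.of_bound
      (c / (1 / 2) * (Real.exp (1 / 2) - 1)) ?_) hlo
    filter_upwards [hBo.mem_nhds hu] with u' hu'
    refine (key u' hu').trans (le_of_eq ?_)
    rw [gronwallBound_of_K_ne_0 (by norm_num)]
    simp only [norm_pow, norm_norm, NNReal.coe_div, NNReal.coe_one, NNReal.coe_ofNat]
    ring_nf

/-- Near each point, a smooth completely integrable system has a solution through every point. -/
theorem exists_ball_solutions [CompleteSpace V] {A : E → E →L[ℝ] V →L[ℝ] V} {U : Set E}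
    (hU : IsOpen U) (hA : ContDiffOn ℝ ∞ A U) (hint : ∀ u ∈ U, IntegrableAt A u)
    {u₀ : E} (hu₀ : u₀ ∈ U) :
    ∃ ρ > 0, ball u₀ ρ ⊆ U ∧ ∀ a ∈ ball u₀ ρ, ∀ v : V,
      ∃ Y : E → V, Y a = v ∧ ∀ u ∈ ball u₀ ρ, SolvesAt A Y u := by
  have hAt : ContDiffAt ℝ ∞ A u₀ := hA.contDiffAt (hU.mem_nhds hu₀)
  have hAt' : ContDiffAt ℝ 1 (fderiv ℝ A) u₀ := hAt.fderiv_right (by norm_cast)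
  obtain ⟨K, s, hs, hKs⟩ := hAt'.exists_lipschitzOnWith
  have e1 : ∀ᶠ w in 𝓝 u₀, ‖A w‖ ≤ ‖A u₀‖ + 1 :=
    (hAt.continuousAt.norm.eventually_lt_const (lt_add_one _)).mono fun _ h => h.le
  have e2 : ∀ᶠ w in 𝓝 u₀, ‖fderiv ℝ A w‖ ≤ ‖fderiv ℝ A u₀‖ + 1 :=
    (hAt'.continuousAt.norm.eventually_lt_const (lt_add_one _)).mono fun _ h => h.le
  obtain ⟨R, hR, h⟩ := Metric.eventually_nhds_iff_ball.1
    (((e1.and e2).and hs).and (hU.mem_nhds hu₀))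
  set M := ‖A u₀‖ + 1
  have hM0 : 0 < M := by positivity
  -- The ball has diameter at most `2 * ρ`, and `M * (2 * ρ) ≤ 1 / 2` is what the one-step ODE
  -- needs. The radius does not depend on the initial value.
  set ρ := min R (1 / (4 * M)) with hρ
  have hρ0 : 0 < ρ := lt_min hR (by positivity)
  have hB : ∀ w ∈ ball u₀ ρ, w ∈ ball u₀ R := fun w hw => ball_subset_ball (min_le_left _ _) hw
  have hdiff : ∀ w ∈ ball u₀ ρ, HasFDerivAt A (fderiv ℝ A w) w := fun w hw =>
    ((hA.contDiffAt (hU.mem_nhds (h w (hB w hw)).2)).differentiableAt (by simp)).hasFDerivAt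
  refine ⟨ρ, hρ0, fun w hw => (h w (hB w hw)).2, fun a ha v => ?_⟩
  refine exists_solution_of_convex (M := M) (D := 2 * ρ) (K := max K (‖fderiv ℝ A u₀‖ + 1))
    (by positivity) ?_ isOpen_ball (convex_ball _ _) hdiff
    (fun w hw => (h w (hB w hw)).1.1.1)
    (fun w hw => (h w (hB w hw)).1.1.2.trans (le_max_right _ _)) ?_ ?_
    (fun w hw => hint w (h w (hB w hw)).2) ha v
  · have : ρ ≤ 1 / (4 * M) := min_le_right _ _
    rw [le_div_iff₀ (by positivity)] at this
    linarith
  · intro w hw w' hw'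
    have hsub : segment ℝ w w' ⊆ ball u₀ ρ := (convex_ball _ _).segment_subset hw hw'
    -- The quadratic Taylor estimate: on the segment the Lipschitz derivative stays within `K * ‖w'
    -- - w‖` of its value at `w`.
    have := Convex.norm_image_sub_le_of_norm_hasFDerivWithin_le' (f := A) (f' := fderiv ℝ A)
      (C := K * ‖w' - w‖) (s := segment ℝ w w') (φ := fderiv ℝ A w) (x := w) (y := w')
      (fun z hz => (hdiff z (hsub hz)).hasFDerivWithinAt) (fun z hz => by
        refine (hKs.norm_sub_le (h z (hB z (hsub hz))).1.2 (h w (hB w hw)).1.2).trans ?_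
        gcongr
        exact norm_sub_le_of_mem_segment hz)
      (convex_segment _ _) (left_mem_segment _ _ _) (right_mem_segment _ _ _)
    refine this.trans ?_
    rw [mul_assoc, ← sq]
    gcongr
    exact le_max_left _ _
  · intro w hw w' hw'
    rw [← dist_eq_norm, two_mul]
    exact (dist_triangle_right _ _ u₀).trans
      (add_le_add (mem_ball.1 hw').le (mem_ball.1 hw).le)

end LocalExistence

/-! ### Global existence, by lifting to the covering formed by solution graphs. -/

/-- The values of type `V` with the discrete topology. -/
structure DiscreteValue (V : Type*) where
  /-- the underlying value -/
  val : V

/-- `V` already carries its norm topology, whereas the fibre of a covering must be discrete; hence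
the copy. -/
instance (V : Type*) : TopologicalSpace (DiscreteValue V) := ⊥

instance (V : Type*) : DiscreteTopology (DiscreteValue V) := ⟨rfl⟩

section GlobalExistence

variable {E V : Type*} [NormedAddCommGroup E] [NormedSpace ℝ E]
  [NormedAddCommGroup V] [NormedSpace ℝ V]

/-- The space `E × V` with the topology whose leaves over `U` are the graphs of the local
solutions of the system `dY = A Y`. -/
structure LeafSpace (A : E → E →L[ℝ] V →L[ℝ] V) (U : Set E) where
  /-- the base point -/
  pt : E
  /-- the value -/
  val : V

variable {A : E → E →L[ℝ] V →L[ℝ] V} {U : Set E}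

/-- Designed so that `u ↦ (u, Y u)` is continuous for each local solution `Y` over `U`; a continuous
section of `pt` is then a continuation of solutions. Points not over `U` are unconstrained. -/
instance : TopologicalSpace (LeafSpace A U) where
  IsOpen W := ∀ z ∈ W, z.pt ∈ U → ∀ Y : E → V, (∀ᶠ u in 𝓝 z.pt, SolvesAt A Y u) →
    Y z.pt = z.val → ∀ᶠ u in 𝓝 z.pt, (⟨u, Y u⟩ : LeafSpace A U) ∈ W
  isOpen_univ := fun _ _ _ _ _ _ => Eventually.of_forall fun _ => mem_univ _
  isOpen_inter := fun _ _ h h' z hz hU Y hY hv =>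
    (h z hz.1 hU Y hY hv).and (h' z hz.2 hU Y hY hv)
  isOpen_sUnion := fun _ hS z ⟨W, hW, hz⟩ hU Y hY hv =>
    (hS W hW z hz hU Y hY hv).mono fun _ h => ⟨W, hW, h⟩

theorem LeafSpace.isOpen_iff {W : Set (LeafSpace A U)} :
    IsOpen W ↔ ∀ z ∈ W, z.pt ∈ U → ∀ Y : E → V, (∀ᶠ u in 𝓝 z.pt, SolvesAt A Y u) →
      Y z.pt = z.val → ∀ᶠ u in 𝓝 z.pt, (⟨u, Y u⟩ : LeafSpace A U) ∈ W := Iff.rfl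

theorem LeafSpace.continuous_pt : Continuous (LeafSpace.pt : LeafSpace A U → E) :=
  ⟨fun _ hB _ hz _ _ _ _ => hB.mem_nhds hz⟩

/-- Local uniqueness: any solution through a point of the graph agrees with `Y` nearby. -/
theorem LeafSpace.isOpen_graph (hU : IsOpen U) (hA : ContinuousOn A U) {B : Set E}
    (hB : IsOpen B) {Y : E → V} (hY : ∀ u ∈ B, SolvesAt A Y u) :
    IsOpen {z : LeafSpace A U | z.pt ∈ B ∧ Y z.pt = z.val} := by
  rw [LeafSpace.isOpen_iff]
  rintro z ⟨hzB, hz⟩ hzU Z hZ hZz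
  filter_upwards [hB.mem_nhds hzB, SolvesAt.eventuallyEq hU hA hzU
    (eventually_of_mem (hB.mem_nhds hzB) hY) hZ (hz.trans hZz.symm)] with u hu hu' using ⟨hu, hu'⟩

/-- Over a ball on which all solutions exist, each solution is labelled by its value at the centre.
Sending `(u, v)` to the label of the solution through it trivializes `pt`, with fibre `V` made
discrete. -/
theorem LeafSpace.isCoveringMapOn (hU : IsOpen U) (hA : ContinuousOn A U)
    (hloc : ∀ u₀ ∈ U, ∃ ρ > 0, ball u₀ ρ ⊆ U ∧ ∀ a ∈ ball u₀ ρ, ∀ v : V,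
      ∃ Y : E → V, Y a = v ∧ ∀ u ∈ ball u₀ ρ, SolvesAt A Y u) :
    IsCoveringMapOn (LeafSpace.pt : LeafSpace A U → E) U := by
  intro u₀ hu₀
  obtain ⟨ρ, hρ, hBU, hsol⟩ := hloc u₀ hu₀
  set B := ball u₀ ρ with hB
  have hu₀B : u₀ ∈ B := mem_ball_self hρ
  have huniq : ∀ Y Z : E → V, (∀ u ∈ B, SolvesAt A Y u) → (∀ u ∈ B, SolvesAt A Z u) →
      ∀ a ∈ B, Y a = Z a → EqOn Y Z B := fun Y Z hY hZ a ha h =>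
    SolvesAt.eqOn_of_convex (convex_ball _ _) (hA.mono hBU) hY hZ ha h
  choose! S hS0 hS using fun v => hsol u₀ hu₀B v
  choose! R hR0 hR using hsol
  -- `S v` is the solution with value `v` at the centre, and `R a v` the one with value `v` at `a`.
  -- Uniqueness on the ball makes passing between them bijective.
  have hSR : ∀ a ∈ B, ∀ v, S (R a v u₀) a = v := fun a ha v => by
    rw [huniq _ (R a v) (hS _) (hR a ha v) u₀ hu₀B (hS0 _) ha, hR0 a ha v]
  have hRS : ∀ a ∈ B, ∀ v, R a (S v a) u₀ = v := fun a ha v => by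
    rw [huniq (R a (S v a)) (S v) (hR a ha _) (hS v) a ha (hR0 a ha _) hu₀B, hS0]
  have hopen : IsOpen (LeafSpace.pt ⁻¹' B : Set (LeafSpace A U)) :=
    isOpen_ball.preimage LeafSpace.continuous_pt
  let H : (LeafSpace.pt ⁻¹' B : Set (LeafSpace A U)) ≃ₜ B × DiscreteValue V :=
    { toFun := fun z => (⟨z.1.pt, z.2⟩, ⟨R z.1.pt z.1.val u₀⟩)
      invFun := fun x => ⟨⟨x.1.1, S x.2.val x.1.1⟩, x.1.2⟩
      left_inv := fun ⟨⟨u, v⟩, hu⟩ => by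
        simp only [Subtype.mk.injEq, LeafSpace.mk.injEq, true_and]
        exact hSR u hu v
      right_inv := fun ⟨⟨u, hu⟩, ⟨v⟩⟩ => by
        simp only [Prod.mk.injEq, DiscreteValue.mk.injEq, true_and]
        exact hRS u hu v
      continuous_toFun := by
        refine Continuous.prodMk ?_ ?_
        · exact (LeafSpace.continuous_pt.comp continuous_subtype_val).subtype_mk _
        · rw [continuous_discrete_rng]
          rintro ⟨v⟩
          refine isOpen_induced_iff.2 ⟨_, LeafSpace.isOpen_graph hU hA isOpen_ball (hS v), ?_⟩
          ext ⟨⟨u, w⟩, hu⟩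
          change u ∈ B at hu
          simp only [mem_preimage, mem_ofPred_eq, mem_singleton_iff, DiscreteValue.mk.injEq]
          constructor
          · rintro ⟨-, rfl⟩
            exact hRS u hu v
          · rintro rfl
            exact ⟨hu, hSR u hu w⟩
      continuous_invFun := by
        refine Continuous.subtype_mk ?_ _
        rw [continuous_def]
        intro W hW
        rw [isOpen_iff_mem_nhds]
        rintro ⟨⟨u, hu⟩, ⟨v⟩⟩ hx
        have h1 := hW _ hx (hBU hu) (S v) (eventually_of_mem (isOpen_ball.mem_nhds hu) (hS v)) rfl
        rw [nhds_prod_eq, nhds_discrete (DiscreteValue V)]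
        have h2 : ∀ᶠ w : B in 𝓝 ⟨u, hu⟩, (⟨w.1, S v w.1⟩ : LeafSpace A U) ∈ W :=
          (continuous_subtype_val (p := fun w => w ∈ B)).continuousAt.eventually
            (p := fun w => (⟨w, S v w⟩ : LeafSpace A U) ∈ W) h1
        have h3 := h2.prod_mk (Filter.eventually_pure (a := (⟨v⟩ : DiscreteValue V)).2 rfl :
          ∀ᶠ y in pure (⟨v⟩ : DiscreteValue V), y = ⟨v⟩)
        filter_upwards [h3] with x hx
        obtain ⟨h4, h5⟩ := hx
        rw [mem_preimage, h5]
        exact h4 }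
  exact IsEvenlyCovered.to_isEvenlyCovered_preimage (I := DiscreteValue V)
    ⟨inferInstance, B, hu₀B, isOpen_ball, hopen, H, fun _ => rfl⟩

/-- On a simply connected open set, a smooth completely integrable system has a solution with an
arbitrary initial value. -/
theorem exists_solution_of_isSimplyConnected [CompleteSpace V] (hU : IsOpen U)
    (hUs : IsSimplyConnected U) (hA : ContDiffOn ℝ ∞ A U) (hint : ∀ u ∈ U, IntegrableAt A u)
    {u₀ : E} (hu₀ : u₀ ∈ U) (v₀ : V) :
    ∃ Y : E → V, Y u₀ = v₀ ∧ ∀ u ∈ U, SolvesAt A Y u := by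
  classical
  have hAc := hA.continuousOn
  have hloc := fun u (hu : u ∈ U) => exists_ball_solutions hU hA hint hu
  have := hUs.simplyConnectedSpace
  have := hU.locallyPathConnectedSpace
  -- The inclusion of `U` lifts through the covering because `U` is simply connected and locally
  -- path connected; the values of the lift are the solution.
  obtain ⟨F, ⟨hF0, hF⟩, -⟩ :=
    (LeafSpace.isCoveringMapOn hU hAc hloc).existsUnique_continuousMap_lifts
    (⟨Subtype.val, continuous_subtype_val⟩ : C(U, E)) (a₀ := ⟨u₀, hu₀⟩) (e₀ := ⟨u₀, v₀⟩) rfl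
    (fun a => a.2)
  have hFpt : ∀ u : U, (F u).pt = u := fun u => congrFun hF u
  obtain ⟨Y, hY⟩ : ∃ Y : E → V, ∀ u : U, Y u = (F u).val :=
    ⟨fun u => if hu : u ∈ U then (F ⟨u, hu⟩).val else 0, by simp⟩
  refine ⟨Y, by rw [hY ⟨u₀, hu₀⟩, hF0], fun u hu => ?_⟩
  obtain ⟨ρ, hρ, hBU, hsol⟩ := hloc u hu
  obtain ⟨Z, hZ0, hZ⟩ := hsol u (mem_ball_self hρ) (F ⟨u, hu⟩).val
  have hW := (LeafSpace.isOpen_graph hU hAc isOpen_ball hZ).preimage F.continuous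
  obtain ⟨O, hO, hOW⟩ := isOpen_induced_iff.1 hW
  have huO : u ∈ O := by
    have : (⟨u, hu⟩ : U) ∈ Subtype.val ⁻¹' O := by
      rw [hOW]
      simp [hFpt, hZ0, hρ]
    exact this
  -- The graph of `Z` is open, so the lift stays in it near `u`, and `Y` inherits the equation from
  -- `Z`.
  have heq : Y =ᶠ[𝓝 u] Z := by
    filter_upwards [hO.mem_nhds huO, hU.mem_nhds hu] with w hw hwU
    have : (⟨w, hwU⟩ : U) ∈ Subtype.val ⁻¹' O := hw
    rw [hOW] at this
    have h2 := this.2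
    rw [hFpt] at h2
    exact (hY ⟨w, hwU⟩).trans h2.symm
  have h1 : HasFDerivAt Z _ u := hZ u (mem_ball_self hρ)
  unfold SolvesAt
  rw [heq.eq_of_nhds]
  exact h1.congr_of_eventuallyEq heq

end GlobalExistence

/-! ### Calculus of partial derivatives. -/

section PartialDerivatives

variable {N : ℕ} {E : Type} [NormedAddCommGroup E] [NormedSpace ℝ E]
  {U : Set (Fin N → ℝ)} {u : Fin N → ℝ} {f g : (Fin N → ℝ) → E} {i j : Fin N}

theorem differentiableAt_of_contDiffOn (hU : IsOpen U) (hf : ContDiffOn ℝ ∞ f U) (hu : u ∈ U) :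
    DifferentiableAt ℝ f u :=
  (hf.contDiffAt (hU.mem_nhds hu)).differentiableAt (by simp)

theorem contDiffOn_pd (hU : IsOpen U) (hf : ContDiffOn ℝ ∞ f U) (i : Fin N) :
    ContDiffOn ℝ ∞ (pd i f) U :=
  (hf.fderiv_of_isOpen hU (by simp)).clm_apply contDiffOn_const

theorem pd_congr_of_eventuallyEq (h : f =ᶠ[𝓝 u] g) : pd i f u = pd i g u := by
  unfold pd
  rw [h.fderiv_eq]

theorem pd_congr (hU : IsOpen U) (h : EqOn f g U) (hu : u ∈ U) : pd i f u = pd i g u :=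
  pd_congr_of_eventuallyEq (eventually_of_mem (hU.mem_nhds hu) h)

theorem fderiv_eq_sum_pd (f : (Fin N → ℝ) → E) (u x : Fin N → ℝ) :
    fderiv ℝ f u x = ∑ i, x i • pd i f u := by
  conv_lhs => rw [pi_eq_sum_univ' x]
  simp only [map_sum, map_smul, pd]

theorem pd_comm (hU : IsOpen U) (hf : ContDiffOn ℝ ∞ f U) (hu : u ∈ U) :
    pd i (pd j f) u = pd j (pd i f) u := by
  have hfu : ContDiffAt ℝ ∞ f u := hf.contDiffAt (hU.mem_nhds hu)
  have hd : DifferentiableAt ℝ (fderiv ℝ f) u :=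
    (hfu.fderiv_right (m := 1) (by norm_cast)).differentiableAt (by simp)
  have h : ∀ k l : Fin N, pd k (pd l f) u =
      fderiv ℝ (fderiv ℝ f) u (Pi.single k 1) (Pi.single l 1) := fun k l => by
    unfold pd
    rw [fderiv_clm_apply hd (differentiableAt_const _)]
    simp
  rw [h, h]
  exact (hfu.isSymmSndFDerivAt (by simp; norm_cast)).eq _ _

theorem pd_add (hf : DifferentiableAt ℝ f u) (hg : DifferentiableAt ℝ g u) :
    pd i (fun v => f v + g v) u = pd i f u + pd i g u := by
  simp [pd, fderiv_fun_add hf hg]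

theorem pd_sub (hf : DifferentiableAt ℝ f u) (hg : DifferentiableAt ℝ g u) :
    pd i (fun v => f v - g v) u = pd i f u - pd i g u := by
  simp [pd, fderiv_fun_sub hf hg]

theorem pd_const (c : E) : pd i (fun _ : Fin N → ℝ => c) u = 0 := by
  simp [pd]

theorem pd_sum {κ : Type*} {s : Finset κ} {f : κ → (Fin N → ℝ) → E}
    (hf : ∀ k ∈ s, DifferentiableAt ℝ (f k) u) :
    pd i (fun v => ∑ k ∈ s, f k v) u = ∑ k ∈ s, pd i (f k) u := by
  simp [pd, fderiv_fun_sum hf]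

theorem pd_clm {F : Type} [NormedAddCommGroup F] [NormedSpace ℝ F] (T : E →L[ℝ] F)
    (hf : DifferentiableAt ℝ f u) : pd i (fun v => T (f v)) u = T (pd i f u) := by
  have h := (T.hasFDerivAt.comp u hf.hasFDerivAt).fderiv
  have h' : fderiv ℝ (fun v => T (f v)) u = T.comp (fderiv ℝ f u) := h
  simp [pd, h']

theorem pd_mul {f g : (Fin N → ℝ) → ℝ} (hf : DifferentiableAt ℝ f u)
    (hg : DifferentiableAt ℝ g u) :
    pd i (fun v => f v * g v) u = pd i f u * g u + f u * pd i g u := by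
  simp only [pd, fderiv_fun_mul hf hg]
  simp
  ring

theorem pd_const_mul {f : (Fin N → ℝ) → ℝ} (c : ℝ) (hf : DifferentiableAt ℝ f u) :
    pd i (fun v => c * f v) u = c * pd i f u := by
  simp only [pd, fderiv_const_mul hf]
  simp

theorem pd_apply {κ : Type} [Fintype κ] {f : (Fin N → ℝ) → κ → ℝ}
    (hf : DifferentiableAt ℝ f u) (e : κ) : pd i f u e = pd i (fun v => f v e) u :=
  (pd_clm (ContinuousLinearMap.proj (R := ℝ) (φ := fun _ : κ => ℝ) e) hf).symm

theorem pd_coord (k : Fin N) : pd i (fun v : Fin N → ℝ => v k) u = if i = k then 1 else 0 := by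
  have : HasFDerivAt (fun v : Fin N → ℝ => v k)
      (ContinuousLinearMap.proj (R := ℝ) (φ := fun _ : Fin N => ℝ) k) u :=
    (ContinuousLinearMap.proj (R := ℝ) (φ := fun _ : Fin N => ℝ) k).hasFDerivAt
  simp [pd, this.fderiv, Pi.single_apply, eq_comm]

/-- A function with vanishing partial derivatives on a connected open set is constant there. -/
theorem eq_of_pd_eq_zero (hU : IsOpen U) (hc : IsPreconnected U)
    (hf : ∀ u ∈ U, DifferentiableAt ℝ f u) (h : ∀ u ∈ U, ∀ i, pd i f u = 0)
    {a : Fin N → ℝ} (ha : a ∈ U) (hu : u ∈ U) : f u = f a := by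
  refine hU.is_const_of_fderiv_eq_zero (𝕜 := ℝ) hc
    (fun w hw => (hf w hw).differentiableWithinAt) (fun w hw => ?_) hu ha
  ext x
  rw [fderiv_eq_sum_pd]
  simp [h w hw]

end PartialDerivatives

/-! ### Linear systems in coordinates, and the Poincaré lemma. -/

section Coordinates

variable {N : ℕ} {ι : Type} [Fintype ι] [DecidableEq ι] {U : Set (Fin N → ℝ)}

set_option maxSynthPendingDepth 6

/-- The bilinear map `(x, y) ↦ xᵢ y_d e_c`. -/
noncomputable def elementaryCLM (i : Fin N) (c d : ι) :
    (Fin N → ℝ) →L[ℝ] (ι → ℝ) →L[ℝ] (ι → ℝ) :=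
  (ContinuousLinearMap.proj (R := ℝ) (φ := fun _ : Fin N => ℝ) i).smulRight
    ((ContinuousLinearMap.proj (R := ℝ) (φ := fun _ : ι => ℝ) d).smulRight
      (Pi.single c (1 : ℝ) : ι → ℝ))

/-- The system `∂ᵢ Y_c = ∑_d a_{icd} Y_d` in invariant form. -/
noncomputable def systemCLM (a : Fin N → ι → ι → (Fin N → ℝ) → ℝ) (u : Fin N → ℝ) :
    (Fin N → ℝ) →L[ℝ] (ι → ℝ) →L[ℝ] (ι → ℝ) :=
  ∑ i, ∑ c, ∑ d, a i c d u • elementaryCLM i c d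

theorem systemCLM_apply (a : Fin N → ι → ι → (Fin N → ℝ) → ℝ) (u x : Fin N → ℝ) (y : ι → ℝ)
    (c : ι) : systemCLM a u x y c = ∑ i, ∑ d, x i * (a i c d u * y d) := by
  simp only [systemCLM, elementaryCLM, sum_apply, smul_apply,
    ContinuousLinearMap.smulRight_apply, ContinuousLinearMap.proj_apply, Finset.sum_apply,
    Pi.smul_apply, smul_eq_mul, Pi.single_apply, mul_ite, mul_one, mul_zero]
  refine Finset.sum_congr rfl fun i _ => ?_
  rw [Finset.sum_comm]
  refine Finset.sum_congr rfl fun d _ => ?_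
  simp only [Finset.sum_ite_eq, Finset.mem_univ, if_true]
  ring

theorem contDiffOn_systemCLM {a : Fin N → ι → ι → (Fin N → ℝ) → ℝ}
    (ha : ∀ i c d, ContDiffOn ℝ ∞ (a i c d) U) : ContDiffOn ℝ ∞ (systemCLM a) U := by
  unfold systemCLM
  exact ContDiffOn.sum fun i _ => ContDiffOn.sum fun c _ => ContDiffOn.sum fun d _ =>
    (ha i c d).smul contDiffOn_const

theorem fderiv_systemCLM {a : Fin N → ι → ι → (Fin N → ℝ) → ℝ} {u : Fin N → ℝ}
    (ha : ∀ i c d, DifferentiableAt ℝ (a i c d) u) (x : Fin N → ℝ) :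
    fderiv ℝ (systemCLM a) u x = systemCLM (fun i c d u => fderiv ℝ (a i c d) u x) u := by
  have h : HasFDerivAt (systemCLM a) (∑ i, ∑ c, ∑ d,
      (fderiv ℝ (a i c d) u).smulRight (elementaryCLM i c d)) u :=
    HasFDerivAt.fun_sum fun i _ => HasFDerivAt.fun_sum fun c _ => HasFDerivAt.fun_sum fun d _ =>
      (ha i c d).hasFDerivAt.smul_const _
  rw [h.fderiv]
  simp only [sum_apply, ContinuousLinearMap.smulRight_apply, systemCLM]

/-- The invariant condition is trilinear in `x`, `y`, `v`; its coefficients are those of `∂ⱼ∂ᵢY` and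
`∂ᵢ∂ⱼY` computed through the system. -/
theorem integrableAt_systemCLM {a : Fin N → ι → ι → (Fin N → ℝ) → ℝ} {u : Fin N → ℝ}
    (ha : ∀ i c d, DifferentiableAt ℝ (a i c d) u)
    (h : ∀ i j c d, pd j (a i c d) u + ∑ e, a i c e u * a j e d u =
      pd i (a j c d) u + ∑ e, a j c e u * a i e d u) :
    IntegrableAt (systemCLM a) u := by
  have key : ∀ (x y : Fin N → ℝ) (v : ι → ℝ) (c : ι),
      (fderiv ℝ (systemCLM a) u x y + (systemCLM a u y).comp (systemCLM a u x)) v c =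
        ∑ i, ∑ j, ∑ d, y i * x j * v d *
          (pd j (a i c d) u + ∑ e, a i c e u * a j e d u) := by
    intro x y v c
    rw [fderiv_systemCLM ha, add_apply, ContinuousLinearMap.comp_apply, Pi.add_apply,
      systemCLM_apply, systemCLM_apply, ← Finset.sum_add_distrib]
    refine Finset.sum_congr rfl fun i _ => ?_
    simp only [systemCLM_apply, fderiv_eq_sum_pd, mul_add, Finset.sum_add_distrib, smul_eq_mul]
    congr 1
    · rw [Finset.sum_comm]
      refine Finset.sum_congr rfl fun d _ => ?_
      rw [Finset.sum_mul, Finset.mul_sum]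
      exact Finset.sum_congr rfl fun j _ => by ring
    · simp only [Finset.mul_sum]
      rw [Finset.sum_comm]
      refine Finset.sum_congr rfl fun j _ => ?_
      rw [Finset.sum_comm]
      exact Finset.sum_congr rfl fun d _ => Finset.sum_congr rfl fun e _ => by ring
  intro x y
  ext v c
  rw [key, key, Finset.sum_comm]
  refine Finset.sum_congr rfl fun i _ => Finset.sum_congr rfl fun j _ =>
    Finset.sum_congr rfl fun d _ => ?_
  rw [h j i c d]
  ring

theorem solvesAt_systemCLM_iff {a : Fin N → ι → ι → (Fin N → ℝ) → ℝ} {u : Fin N → ℝ}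
    {Y : ι → (Fin N → ℝ) → ℝ} (hY : ∀ c, DifferentiableAt ℝ (Y c) u) :
    SolvesAt (systemCLM a) (fun v c => Y c v) u ↔
      ∀ i c, pd i (Y c) u = ∑ d, a i c d u * Y d u := by
  have hY' : DifferentiableAt ℝ (fun v c => Y c v) u := differentiableAt_pi.2 hY
  constructor
  · intro h i c
    have h1 : HasFDerivAt (fun v c => Y c v) _ u := h
    rw [← pd_apply hY' c]
    unfold pd
    rw [h1.fderiv]
    simp only [ContinuousLinearMap.comp_apply, ContinuousLinearMap.apply_apply, systemCLM_apply,
      Pi.single_apply, ite_mul, one_mul, zero_mul]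
    rw [Finset.sum_comm]
    simp
  · intro h
    have : fderiv ℝ (fun v c => Y c v) u =
        (ContinuousLinearMap.apply ℝ (ι → ℝ) (fun c => Y c u)).comp (systemCLM a u) := by
      ext x c
      rw [fderiv_eq_sum_pd]
      simp only [ContinuousLinearMap.comp_apply, ContinuousLinearMap.apply_apply, systemCLM_apply,
        Finset.sum_apply, Pi.smul_apply, smul_eq_mul]
      refine Finset.sum_congr rfl fun i _ => ?_
      rw [pd_apply hY', h, Finset.mul_sum]
    unfold SolvesAt
    rw [← this]
    exact hY'.hasFDerivAt

/-- Existence for completely integrable linear systems of partial differential equations on a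
simply connected open set. -/
theorem exists_linear_system_solution (hU : IsOpen U) (hUs : IsSimplyConnected U)
    {a : Fin N → ι → ι → (Fin N → ℝ) → ℝ} (ha : ∀ i c d, ContDiffOn ℝ ∞ (a i c d) U)
    (h : ∀ u ∈ U, ∀ i j c d, pd j (a i c d) u + ∑ e, a i c e u * a j e d u =
      pd i (a j c d) u + ∑ e, a j c e u * a i e d u)
    {u₀ : Fin N → ℝ} (hu₀ : u₀ ∈ U) (y₀ : ι → ℝ) :
    ∃ Y : ι → (Fin N → ℝ) → ℝ, (∀ c, ContDiffOn ℝ ∞ (Y c) U) ∧ (∀ c, Y c u₀ = y₀ c) ∧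
      ∀ u ∈ U, ∀ i c, pd i (Y c) u = ∑ d, a i c d u * Y d u := by
  obtain ⟨Y, hY0, hY⟩ := exists_solution_of_isSimplyConnected hU hUs (contDiffOn_systemCLM ha)
    (fun u hu => integrableAt_systemCLM
      (fun i c d => differentiableAt_of_contDiffOn hU (ha i c d) hu) (h u hu)) hu₀ y₀
  have hYs := contDiffOn_pi.1 (SolvesAt.contDiffOn hU (contDiffOn_systemCLM ha) hY)
  exact ⟨fun c u => Y u c, hYs, fun c => congrFun hY0 c, fun u hu =>
    (solvesAt_systemCLM_iff (Y := fun c u => Y u c) fun c =>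
      differentiableAt_of_contDiffOn hU (hYs c) hu).1 (hY u hu)⟩

/-- Uniqueness for linear systems of partial differential equations on a connected open set. -/
theorem linear_system_solution_unique (hU : IsOpen U) (hc : IsPreconnected U)
    {a : Fin N → ι → ι → (Fin N → ℝ) → ℝ} (ha : ∀ i c d, ContDiffOn ℝ ∞ (a i c d) U)
    {Y Z : ι → (Fin N → ℝ) → ℝ} (hYs : ∀ c, ContDiffOn ℝ ∞ (Y c) U)
    (hZs : ∀ c, ContDiffOn ℝ ∞ (Z c) U)
    (hY : ∀ u ∈ U, ∀ i c, pd i (Y c) u = ∑ d, a i c d u * Y d u)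
    (hZ : ∀ u ∈ U, ∀ i c, pd i (Z c) u = ∑ d, a i c d u * Z d u)
    {u₀ : Fin N → ℝ} (hu₀ : u₀ ∈ U) (h₀ : ∀ c, Y c u₀ = Z c u₀) {u : Fin N → ℝ} (hu : u ∈ U)
    (c : ι) : Y c u = Z c u :=
  congrFun (SolvesAt.eqOn_of_isPreconnected (Y := fun v c => Y c v) (Z := fun v c => Z c v)
    hU hc (contDiffOn_systemCLM ha).continuousOn
    (fun w hw => (solvesAt_systemCLM_iff fun c =>
      differentiableAt_of_contDiffOn hU (hYs c) hw).2 (hY w hw))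
    (fun w hw => (solvesAt_systemCLM_iff fun c =>
      differentiableAt_of_contDiffOn hU (hZs c) hw).2 (hZ w hw)) hu₀ (funext h₀) hu) c

/-- The Poincaré lemma for closed one-forms on a simply connected open set. -/
theorem exists_potential (hU : IsOpen U) (hUs : IsSimplyConnected U)
    {f : Fin N → (Fin N → ℝ) → ℝ} (hf : ∀ i, ContDiffOn ℝ ∞ (f i) U)
    (h : ∀ u ∈ U, ∀ i j, pd j (f i) u = pd i (f j) u) :
    ∃ ψ : (Fin N → ℝ) → ℝ, ContDiffOn ℝ ∞ ψ U ∧ ∀ u ∈ U, ∀ i, pd i ψ u = f i u := by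
  obtain ⟨u₀, hu₀⟩ := hUs.nonempty
  -- The inhomogeneous equation `∂ᵢψ = fᵢ` becomes linear once the constant `1` is adjoined as a
  -- second unknown: `Y false = 1` and `Y true = ψ`.
  let a : Fin N → Bool → Bool → (Fin N → ℝ) → ℝ := fun i c d =>
    match c, d with
    | true, false => f i
    | _, _ => fun _ => 0
  have ha : ∀ i c d, ContDiffOn ℝ ∞ (a i c d) U := by
    rintro i (_ | _) (_ | _)
    · exact contDiffOn_const
    · exact contDiffOn_const
    · exact hf i
    · exact contDiffOn_const
  obtain ⟨Y, hYs, hY0, hY⟩ := exists_linear_system_solution hU hUs ha (by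
    rintro u hu i j (_ | _) (_ | _) <;> simp [a, pd_const, h u hu i j]) hu₀
    (fun c : Bool => if c then 0 else 1)
  refine ⟨Y true, hYs true, fun u hu i => ?_⟩
  have h1 : Y false u = Y false u₀ := eq_of_pd_eq_zero hU
    hUs.isPathConnected.isConnected.isPreconnected
    (fun w hw => differentiableAt_of_contDiffOn hU (hYs false) hw)
    (fun w hw i => by simp [hY w hw, a]) hu₀ hu
  rw [hY u hu]
  simp [a, h1, hY0]

/-- Two solutions of the system `∂ₖ S_{cd} = ∑ₑ a_{kce} S_{ed} + ∑ₑ a_{kde} S_{ce}` induced on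
bilinear forms that agree at one point are equal. -/
theorem bilinear_system_solution_unique (hU : IsOpen U) (hc : IsPreconnected U)
    {a : Fin N → ι → ι → (Fin N → ℝ) → ℝ} (ha : ∀ i c d, ContDiffOn ℝ ∞ (a i c d) U)
    {S S' : ι → ι → (Fin N → ℝ) → ℝ} (hSs : ∀ c d, ContDiffOn ℝ ∞ (S c d) U)
    (hSs' : ∀ c d, ContDiffOn ℝ ∞ (S' c d) U)
    (hS : ∀ u ∈ U, ∀ k c d, pd k (S c d) u =
      ∑ e, a k c e u * S e d u + ∑ e, a k d e u * S c e u)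
    (hS' : ∀ u ∈ U, ∀ k c d, pd k (S' c d) u =
      ∑ e, a k c e u * S' e d u + ∑ e, a k d e u * S' c e u)
    {u₀ : Fin N → ℝ} (hu₀ : u₀ ∈ U) (h₀ : ∀ c d, S c d u₀ = S' c d u₀) {u : Fin N → ℝ}
    (hu : u ∈ U) (c d : ι) : S c d u = S' c d u := by
  -- Rewritten over pairs of indices, the induced system is an ordinary linear one, with
  -- coefficients `a ⊗ 1 + 1 ⊗ a`.
  have hsum : ∀ (T : ι → ι → (Fin N → ℝ) → ℝ) (w : Fin N → ℝ) (k : Fin N) (x : ι × ι),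
      ∑ e, a k x.1 e w * T e x.2 w + ∑ e, a k x.2 e w * T x.1 e w =
        ∑ y : ι × ι, ((if y.2 = x.2 then a k x.1 y.1 w else 0) +
          (if y.1 = x.1 then a k x.2 y.2 w else 0)) * T y.1 y.2 w := by
    intro T w k x
    simp only [add_mul, Finset.sum_add_distrib, Fintype.sum_prod_type, ite_mul, zero_mul]
    congr 1
    · simp
    · rw [Finset.sum_comm]
      simp
  refine linear_system_solution_unique (ι := ι × ι) hU hc
    (a := fun k x y w => (if y.2 = x.2 then a k x.1 y.1 w else 0) +
      (if y.1 = x.1 then a k x.2 y.2 w else 0))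
    (Y := fun x => S x.1 x.2) (Z := fun x => S' x.1 x.2) (fun k x y => ?_)
    (fun x => hSs _ _) (fun x => hSs' _ _) (fun w hw k x => ?_) (fun w hw k x => ?_) hu₀
    (fun x => h₀ _ _) hu (c, d)
  · refine ContDiffOn.add ?_ ?_
    · split_ifs
      · exact ha _ _ _
      · exact contDiffOn_const
    · split_ifs
      · exact ha _ _ _
      · exact contDiffOn_const
  · rw [hS w hw, hsum S]
  · rw [hS' w hw, hsum S']

end Coordinates

/-! ### The scalar product of signature `(p, q)`. -/

section PseudoInner

variable {p q : ℕ}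

/-- The scalar product of signature `(p, q)` as a bilinear map. -/
noncomputable def pseudoBilin (p q : ℕ) : PseudoE p q →ₗ[ℝ] PseudoE p q →ₗ[ℝ] ℝ :=
  LinearMap.mk₂ ℝ pseudoInner
    (fun x x' y => by simp [pseudoInner, add_mul, Finset.sum_add_distrib]; ring)
    (fun c x y => by simp [pseudoInner, mul_assoc, Finset.mul_sum, mul_sub])
    (fun x y y' => by simp [pseudoInner, mul_add, Finset.sum_add_distrib]; ring)
    (fun c x y => by
      simp only [pseudoInner, Pi.smul_apply, smul_eq_mul, mul_sub, Finset.mul_sum]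
      congr 1 <;> exact Finset.sum_congr rfl fun _ _ => by ring)

theorem pseudoBilin_apply (x y : PseudoE p q) : pseudoBilin p q x y = pseudoInner x y := rfl

theorem pseudoInner_comm (x y : PseudoE p q) : pseudoInner x y = pseudoInner y x := by
  simp [pseudoInner, mul_comm]

theorem pseudoInner_add_left (x x' y : PseudoE p q) :
    pseudoInner (x + x') y = pseudoInner x y + pseudoInner x' y := by
  simp [← pseudoBilin_apply]

theorem pseudoInner_add_right (x y y' : PseudoE p q) :
    pseudoInner x (y + y') = pseudoInner x y + pseudoInner x y' := by
  simp [← pseudoBilin_apply]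

theorem pseudoInner_sub_left (x x' y : PseudoE p q) :
    pseudoInner (x - x') y = pseudoInner x y - pseudoInner x' y := by
  simp [← pseudoBilin_apply]

theorem pseudoInner_smul_left (c : ℝ) (x y : PseudoE p q) :
    pseudoInner (c • x) y = c * pseudoInner x y := by
  simp [← pseudoBilin_apply]

theorem pseudoInner_smul_right (c : ℝ) (x y : PseudoE p q) :
    pseudoInner x (c • y) = c * pseudoInner x y := by
  simp [← pseudoBilin_apply]

theorem pseudoInner_zero_left (y : PseudoE p q) : pseudoInner 0 y = 0 := by
  simp [← pseudoBilin_apply]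

theorem pseudoInner_sum_left {κ : Type*} (s : Finset κ) (f : κ → PseudoE p q) (y : PseudoE p q) :
    pseudoInner (∑ k ∈ s, f k) y = ∑ k ∈ s, pseudoInner (f k) y := by
  simp [← pseudoBilin_apply]

theorem pseudoInner_sum_right {κ : Type*} (s : Finset κ) (f : κ → PseudoE p q)
    (y : PseudoE p q) : pseudoInner y (∑ k ∈ s, f k) = ∑ k ∈ s, pseudoInner y (f k) := by
  simp [← pseudoBilin_apply]

theorem eq_zero_of_pseudoInner_eq_zero {x : PseudoE p q} (h : ∀ y, pseudoInner x y = 0) :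
    x = 0 := by
  ext c
  rcases c with a | b
  · simpa [pseudoInner, Pi.single_apply] using h (Pi.single (Sum.inl a) 1)
  · simpa [pseudoInner, Pi.single_apply] using h (Pi.single (Sum.inr b) 1)

theorem contDiffOn_pseudoInner {N : ℕ} {U : Set (Fin N → ℝ)} {f g : (Fin N → ℝ) → PseudoE p q}
    (hf : ContDiffOn ℝ ∞ f U) (hg : ContDiffOn ℝ ∞ g U) :
    ContDiffOn ℝ ∞ (fun v => pseudoInner (f v) (g v)) U := by
  have hf' := contDiffOn_pi.1 hf
  have hg' := contDiffOn_pi.1 hg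
  unfold pseudoInner
  exact (ContDiffOn.sum fun a _ => (hf' _).mul (hg' _)).sub
    (ContDiffOn.sum fun a _ => (hf' _).mul (hg' _))

theorem pd_pseudoInner {N : ℕ} {u : Fin N → ℝ} {f g : (Fin N → ℝ) → PseudoE p q} {i : Fin N}
    (hf : DifferentiableAt ℝ f u) (hg : DifferentiableAt ℝ g u) :
    pd i (fun v => pseudoInner (f v) (g v)) u =
      pseudoInner (pd i f u) (g u) + pseudoInner (f u) (pd i g u) := by
  let B := (pseudoBilin p q).toContinuousBilinearMap
  have h := (B.hasFDerivAt_of_bilinear hf.hasFDerivAt hg.hasFDerivAt).fderiv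
  have h' : fderiv ℝ (fun v => pseudoInner (f v) (g v)) u = _ := h
  unfold pd
  rw [h']
  simp only [add_apply, ContinuousLinearMap.precompR_apply, ContinuousLinearMap.precompL_apply]
  rw [add_comm]
  rfl

end PseudoInner

/-! ### Gram matrices and expansion in a basis. -/

section Gram

variable {p q : ℕ} {ι : Type*} [Fintype ι] {G : Matrix ι ι ℝ}
  {b : ι → PseudoE p q}

theorem linearIndependent_of_gram [DecidableEq ι] (hG : G.det ≠ 0)
    (hb : ∀ c d, pseudoInner (b c) (b d) = G c d) :
    LinearIndependent ℝ b := by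
  rw [Fintype.linearIndependent_iff]
  intro g hg
  have : Matrix.vecMul g G = 0 := by
    ext d
    have := congrArg (fun x => pseudoInner x (b d)) hg
    simp only [pseudoInner_sum_left, pseudoInner_smul_left, hb, pseudoInner_zero_left] at this
    simpa [Matrix.vecMul, dotProduct] using this
  exact congrFun (Matrix.eq_zero_of_vecMul_eq_zero hG this)

theorem span_eq_top_of_card (hb : LinearIndependent ℝ b) (hcard : Fintype.card ι = p + q) :
    Submodule.span ℝ (range b) = ⊤ :=
  hb.span_eq_top_of_card_eq_finrank' (by simp [hcard])

theorem eq_zero_of_orthogonal_basis (hb : LinearIndependent ℝ b)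
    (hcard : Fintype.card ι = p + q) {x : PseudoE p q} (h : ∀ c, pseudoInner x (b c) = 0) :
    x = 0 := by
  refine eq_zero_of_pseudoInner_eq_zero fun y => ?_
  have hy : y ∈ Submodule.span ℝ (range b) := by
    rw [span_eq_top_of_card hb hcard]
    trivial
  have hle : Submodule.span ℝ (range b) ≤ LinearMap.ker (pseudoBilin p q x) := by
    rw [Submodule.span_le]
    rintro _ ⟨c, rfl⟩
    exact h c
  exact hle hy

/-- A kernel vector of `G` would give a nontrivial combination of the basis orthogonal to the whole
basis, contradicting nondegeneracy of the scalar product. -/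
theorem gram_det_ne_zero [DecidableEq ι] (hli : LinearIndependent ℝ b)
    (hcard : Fintype.card ι = p + q)
    (hb : ∀ c d, pseudoInner (b c) (b d) = G c d) : G.det ≠ 0 := by
  intro h0
  obtain ⟨v, hv, hGv⟩ := Matrix.exists_vecMul_eq_zero_iff.2 h0
  have hx : ∑ c, v c • b c = 0 := eq_zero_of_orthogonal_basis hli hcard fun d => by
    simp only [pseudoInner_sum_left, pseudoInner_smul_left, hb]
    exact congrFun hGv d
  exact hv (funext fun c => Fintype.linearIndependent_iff.1 hli v hx c)

theorem expand_of_gram [DecidableEq ι] (hG : G.det ≠ 0)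
    (hb : ∀ c d, pseudoInner (b c) (b d) = G c d)
    (hcard : Fintype.card ι = p + q) (x : PseudoE p q) :
    x = ∑ c, (∑ d, G⁻¹ c d * pseudoInner x (b d)) • b c := by
  have hsymm : G.IsSymm := by
    ext c d
    rw [Matrix.transpose_apply, ← hb, ← hb, pseudoInner_comm]
  rw [← sub_eq_zero]
  refine eq_zero_of_orthogonal_basis (linearIndependent_of_gram hG hb) hcard fun e => ?_
  simp only [pseudoInner_sub_left, pseudoInner_sum_left, pseudoInner_smul_left, hb,
    Finset.sum_mul]
  rw [Finset.sum_comm]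
  have h1 : ∀ d, ∑ c, G⁻¹ c d * G c e = (1 : Matrix ι ι ℝ) d e := fun d => by
    rw [← Matrix.nonsing_inv_mul G (isUnit_iff_ne_zero.2 hG), Matrix.mul_apply]
    refine Finset.sum_congr rfl fun c _ => ?_
    rw [← Matrix.transpose_apply G⁻¹ d c, Matrix.transpose_nonsing_inv, hsymm.eq]
  have h2 : ∀ d, ∑ c, G⁻¹ c d * pseudoInner x (b d) * G c e =
      pseudoInner x (b d) * (1 : Matrix ι ι ℝ) d e := fun d => by
    rw [← h1, Finset.mul_sum]
    exact Finset.sum_congr rfl fun c _ => by ring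
  simp [h2, Matrix.one_apply]

end Gram

/-! ### Frames with Gram matrix `diag(η, μ)`. -/

section Frame

variable {N L p q : ℕ} {η : Matrix (Fin N) (Fin N) ℝ} {μ : Matrix (Fin L) (Fin L) ℝ}
  {t : Fin N → PseudoE p q} {n : Fin L → PseudoE p q}

/-- The vectors `t` and `n` form a frame with Gram matrix `diag(η, μ)`. -/
structure IsFrame (η : Matrix (Fin N) (Fin N) ℝ) (μ : Matrix (Fin L) (Fin L) ℝ)
    (t : Fin N → PseudoE p q) (n : Fin L → PseudoE p q) : Prop where
  tangent : ∀ i j, pseudoInner (t i) (t j) = η i j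
  normal : ∀ α i, pseudoInner (n α) (t i) = 0
  gram : ∀ α β, pseudoInner (n α) (n β) = μ α β

theorem IsFrame.gram_elim (h : IsFrame η μ t n) (c d : Fin N ⊕ Fin L) :
    pseudoInner (Sum.elim t n c) (Sum.elim t n d) = Matrix.fromBlocks η 0 0 μ c d := by
  rcases c with i | α <;> rcases d with j | β <;> simp [h.tangent, h.normal, h.gram]
  rw [pseudoInner_comm, h.normal]

theorem det_blocks_ne_zero (hη : η.det ≠ 0) (hμ : μ.det ≠ 0) :
    (Matrix.fromBlocks η 0 0 μ).det ≠ 0 := by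
  rw [Matrix.det_fromBlocks_zero₂₁]
  exact mul_ne_zero hη hμ

theorem inv_blocks (hη : η.det ≠ 0) (hμ : μ.det ≠ 0) :
    (Matrix.fromBlocks η 0 0 μ)⁻¹ = Matrix.fromBlocks η⁻¹ 0 0 μ⁻¹ := by
  refine Matrix.inv_eq_left_inv ?_
  simp [Matrix.fromBlocks_multiply, Matrix.nonsing_inv_mul _ (isUnit_iff_ne_zero.2 hη),
    Matrix.nonsing_inv_mul _ (isUnit_iff_ne_zero.2 hμ)]

theorem IsFrame.linearIndependent (h : IsFrame η μ t n) (hη : η.det ≠ 0) (hμ : μ.det ≠ 0) :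
    LinearIndependent ℝ (Sum.elim t n) :=
  linearIndependent_of_gram (det_blocks_ne_zero hη hμ) h.gram_elim

theorem IsFrame.isMetric (h : IsFrame η μ t n) (hpq : p + q = N + L)
    (hli : LinearIndependent ℝ (Sum.elim t n)) : IsMetric η ∧ IsMetric μ := by
  have hdet := gram_det_ne_zero hli (by simp [hpq]) h.gram_elim
  rw [Matrix.det_fromBlocks_zero₂₁] at hdet
  refine ⟨⟨?_, left_ne_zero_of_mul hdet⟩, ⟨?_, right_ne_zero_of_mul hdet⟩⟩
  · ext i j
    rw [Matrix.transpose_apply, ← h.tangent, ← h.tangent, pseudoInner_comm]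
  · ext i j
    rw [Matrix.transpose_apply, ← h.gram, ← h.gram, pseudoInner_comm]

theorem IsFrame.expand (h : IsFrame η μ t n) (hη : η.det ≠ 0) (hμ : μ.det ≠ 0)
    (hpq : p + q = N + L) (x : PseudoE p q) :
    x = ∑ i, (∑ j, η⁻¹ i j * pseudoInner x (t j)) • t i +
      ∑ α, (∑ β, μ⁻¹ α β * pseudoInner x (n β)) • n α := by
  have := expand_of_gram (det_blocks_ne_zero hη hμ) h.gram_elim (by simp [hpq]) x
  simpa [inv_blocks hη hμ] using this

theorem IsFrame.pseudoInner_eq (h : IsFrame η μ t n) (hη : η.det ≠ 0) (hμ : μ.det ≠ 0)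
    (hpq : p + q = N + L) (x y : PseudoE p q) :
    pseudoInner x y = ∑ i, ∑ j, η⁻¹ i j * (pseudoInner x (t i) * pseudoInner y (t j)) +
      ∑ α, ∑ β, μ⁻¹ α β * (pseudoInner x (n α) * pseudoInner y (n β)) := by
  conv_lhs => rw [h.expand hη hμ hpq y]
  simp only [pseudoInner_add_right, pseudoInner_sum_right, pseudoInner_smul_right, Finset.sum_mul]
  congr 1 <;>
    exact Finset.sum_congr rfl fun _ _ => Finset.sum_congr rfl fun _ _ => by ring

end Frame

/-! ### Signatures, and existence of a frame at one point. -/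

section Signature

open QuadraticMap QuadraticForm

theorem weightedSumSquares_prod_equivalent {κ κ' : Type*} [Fintype κ] [Fintype κ'] (w : κ → ℝ)
    (w' : κ' → ℝ) : Equivalent ((weightedSumSquares ℝ w).prod (weightedSumSquares ℝ w'))
      (weightedSumSquares ℝ (Sum.elim w w')) :=
  ⟨{ (LinearEquiv.sumArrowLequivProdArrow κ κ' ℝ ℝ).symm with
    map_app' := fun x => by
      simp [weightedSumSquares_apply, LinearEquiv.sumArrowLequivProdArrow]
      rfl }⟩

theorem ncard_setOf_sumElim {κ κ' : Type*} [Finite κ] [Finite κ'] (w : κ → ℝ) (w' : κ' → ℝ)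
    (P : ℝ → Prop) :
    {i | P (Sum.elim w w' i)}.ncard = {i | P (w i)}.ncard + {i | P (w' i)}.ncard := by
  have : {i | P (Sum.elim w w' i)} = Sum.inl '' {i | P (w i)} ∪ Sum.inr '' {i | P (w' i)} := by
    ext (i | i) <;> simp
  rw [this, Set.ncard_union_eq _ (Set.toFinite _) (Set.toFinite _),
    Set.ncard_image_of_injective _ Sum.inl_injective,
    Set.ncard_image_of_injective _ Sum.inr_injective]
  rw [Set.disjoint_left]
  rintro _ ⟨i, -, rfl⟩ ⟨j, -, h⟩
  simp at h

/-- Diagonalize both forms and count signs of weights; Sylvester's law makes the counts independent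
of the diagonalization. -/
theorem sig_prod {M M' : Type*} [AddCommGroup M] [Module ℝ M] [FiniteDimensional ℝ M]
    [AddCommGroup M'] [Module ℝ M'] [FiniteDimensional ℝ M'] (Q : QuadraticForm ℝ M)
    (Q' : QuadraticForm ℝ M') :
    sigPos (Q.prod Q') = sigPos Q + sigPos Q' ∧ sigNeg (Q.prod Q') = sigNeg Q + sigNeg Q' := by
  have : Invertible (2 : ℝ) := invertibleOfNonzero two_ne_zero
  obtain ⟨w, hw⟩ := Q.equivalent_weightedSumSquares
  obtain ⟨w', hw'⟩ := Q'.equivalent_weightedSumSquares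
  have h : Equivalent (Q.prod Q') (weightedSumSquares ℝ (Sum.elim w w')) := by
    refine Equivalent.trans ?_ (weightedSumSquares_prod_equivalent w w')
    obtain ⟨e⟩ := hw
    obtain ⟨e'⟩ := hw'
    exact ⟨e.prod e'⟩
  rw [sigPos_of_equiv_weightedSumSquares h, sigNeg_of_equiv_weightedSumSquares h,
    sigPos_of_equiv_weightedSumSquares hw, sigNeg_of_equiv_weightedSumSquares hw,
    sigPos_of_equiv_weightedSumSquares hw', sigNeg_of_equiv_weightedSumSquares hw']
  exact ⟨ncard_setOf_sumElim w w' (fun x => 0 < x), ncard_setOf_sumElim w w' (fun x => x < 0)⟩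

/-- The weights of the standard quadratic form of signature `(p, q)`. -/
def pseudoWeights (p q : ℕ) : Fin p ⊕ Fin q → ℝ := Sum.elim (fun _ => 1) (fun _ => -1)

theorem weightedSumSquares_pseudoWeights {p q : ℕ} (x : PseudoE p q) :
    weightedSumSquares ℝ (pseudoWeights p q) x = pseudoInner x x := by
  simp [weightedSumSquares_apply, pseudoWeights, pseudoInner, sub_eq_add_neg]

theorem sig_pseudoWeights (p q : ℕ) :
    sigPos (weightedSumSquares ℝ (pseudoWeights p q)) = p ∧
      sigNeg (weightedSumSquares ℝ (pseudoWeights p q)) = q := by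
  rw [sigPos_weightedSumSquares, sigNeg_weightedSumSquares]
  unfold pseudoWeights
  rw [ncard_setOf_sumElim _ _ (fun x => 0 < x), ncard_setOf_sumElim _ _ (fun x => x < 0)]
  norm_num [Set.ncard_univ]

variable {N L p q : ℕ} {η : Matrix (Fin N) (Fin N) ℝ} {μ : Matrix (Fin L) (Fin L) ℝ}

theorem toQuadraticForm'_apply {k : ℕ} (A : Matrix (Fin k) (Fin k) ℝ) (x : Fin k → ℝ) :
    A.toQuadraticForm' x = ∑ i, ∑ j, x i * x j * A i j := by
  simp only [Matrix.toQuadraticForm', LinearMap.BilinMap.toQuadraticMap_apply,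
    Matrix.toLinearMap₂'_apply', dotProduct, Matrix.mulVec, Finset.mul_sum]
  exact Finset.sum_congr rfl fun _ _ => Finset.sum_congr rfl fun _ _ => by ring

/-- Coordinates in the frame are an isometry from the orthogonal sum of `η` and `μ` to the standard
form, and signature is an isometry invariant. -/
theorem IsFrame.signatureSum {t : Fin N → PseudoE p q} {n : Fin L → PseudoE p q}
    (h : IsFrame η μ t n) (hη : η.det ≠ 0) (hμ : μ.det ≠ 0) (hpq : p + q = N + L) :
    SignatureSum p q η μ := by
  have hli := h.linearIndependent hη hμ
  let b : Module.Basis (Fin N ⊕ Fin L) ℝ (PseudoE p q) :=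
    Module.Basis.mk hli (span_eq_top_of_card hli (by simp [hpq])).ge
  have hequiv : Equivalent (η.toQuadraticForm'.prod μ.toQuadraticForm')
      (weightedSumSquares ℝ (pseudoWeights p q)) := by
    refine ⟨{ (LinearEquiv.sumArrowLequivProdArrow (Fin N) (Fin L) ℝ ℝ).symm.trans
      b.equivFun.symm with map_app' := fun x => ?_ }⟩
    have : (((LinearEquiv.sumArrowLequivProdArrow (Fin N) (Fin L) ℝ ℝ).symm.trans
      b.equivFun.symm) x) = ∑ i, x.1 i • t i + ∑ α, x.2 α • n α := by
      simp [b, Module.Basis.equivFun_symm_apply, LinearEquiv.sumArrowLequivProdArrow]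
      rfl
    change weightedSumSquares ℝ (pseudoWeights p q) (((LinearEquiv.sumArrowLequivProdArrow
      (Fin N) (Fin L) ℝ ℝ).symm.trans b.equivFun.symm) x) = _
    rw [this, weightedSumSquares_pseudoWeights, QuadraticMap.prod_apply, toQuadraticForm'_apply,
      toQuadraticForm'_apply]
    have hn : ∀ i α, pseudoInner (t i) (n α) = 0 := fun i α => by
      rw [pseudoInner_comm, h.normal]
    simp only [pseudoInner_add_left, pseudoInner_add_right, pseudoInner_sum_left,
      pseudoInner_sum_right, pseudoInner_smul_left, pseudoInner_smul_right, h.tangent, h.normal,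
      h.gram, hn, mul_zero, Finset.sum_const_zero, add_zero, zero_add, mul_assoc, Finset.mul_sum]
    congr 1 <;>
      rw [Finset.sum_comm] <;>
      exact Finset.sum_congr rfl fun _ _ => Finset.sum_congr rfl fun _ _ => by ring
  obtain ⟨h1, h2⟩ := sig_prod η.toQuadraticForm' μ.toQuadraticForm'
  obtain ⟨h3, h4⟩ := sig_pseudoWeights p q
  rw [hequiv.sigPos_eq, h3] at h1
  rw [hequiv.sigNeg_eq, h4] at h2
  exact ⟨h1, h2⟩

/-- Sorting the weights by sign gives a bijection of index sets that permutes coordinates into the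
standard form. -/
theorem equivalent_pseudoWeights {κ : Type*} [Fintype κ] {w : κ → ℝ}
    (hw : ∀ k, w k = -1 ∨ w k = 1) (hp : {k | 0 < w k}.ncard = p) (hq : {k | w k < 0}.ncard = q) :
    Equivalent (weightedSumSquares ℝ w) (weightedSumSquares ℝ (pseudoWeights p q)) := by
  classical
  have e1 : Nonempty ({k // 0 < w k} ≃ Fin p) := by
    refine ⟨Finite.equivFinOfCardEq ?_⟩
    rw [← hp]
    rfl
  have e2 : Nonempty ({k // ¬ 0 < w k} ≃ Fin q) := by
    refine ⟨Finite.equivFinOfCardEq ?_⟩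
    rw [← hq]
    have : {k | w k < 0} = {k | ¬ 0 < w k} := by
      ext k
      rcases hw k with h | h <;> norm_num [h]
    rw [this]
    rfl
  obtain ⟨e1⟩ := e1
  obtain ⟨e2⟩ := e2
  let σ : Fin p ⊕ Fin q ≃ κ := (Equiv.sumCongr e1.symm e2.symm).trans (Equiv.sumCompl _)
  have hσ : ∀ c, w (σ c) = pseudoWeights p q c := by
    rintro (a | c)
    · have h := (e1.symm a).2
      rcases hw (σ (Sum.inl a)) with h' | h'
      · have : σ (Sum.inl a) = (e1.symm a).1 := rfl
        rw [this] at h'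
        rw [h'] at h
        norm_num at h
      · exact h'
    · have h := (e2.symm c).2
      rcases hw (σ (Sum.inr c)) with h' | h'
      · exact h'
      · have : σ (Sum.inr c) = (e2.symm c).1 := rfl
        rw [this] at h'
        rw [h'] at h
        norm_num at h
  refine ⟨{ LinearEquiv.funCongrLeft ℝ ℝ σ with map_app' := fun x => ?_ }⟩
  change weightedSumSquares ℝ (pseudoWeights p q) (LinearEquiv.funCongrLeft ℝ ℝ σ x) = _
  simp only [weightedSumSquares_apply, LinearEquiv.funCongrLeft_apply, LinearMap.funLeft_apply,
    ← hσ]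
  exact σ.sum_comp (fun k => w k • (x k * x k))

theorem polar_toQuadraticForm' {k : ℕ} {A : Matrix (Fin k) (Fin k) ℝ} (hA : A.IsSymm)
    (i j : Fin k) : polar A.toQuadraticForm' (Pi.single i (1 : ℝ) : Fin k → ℝ)
      (Pi.single j (1 : ℝ) : Fin k → ℝ) = 2 * A i j := by
  have h : ∀ i j, Matrix.toLinearMap₂' ℝ A (Pi.single i (1 : ℝ) : Fin k → ℝ)
      (Pi.single j (1 : ℝ) : Fin k → ℝ) = A i j :=
    fun i j => by rw [Matrix.toLinearMap₂'_apply']; simp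
  rw [Matrix.toQuadraticForm', LinearMap.BilinMap.polar_toQuadraticMap, h, h, hA.apply]
  ring

theorem separatingLeft_toQuadraticForm' {k : ℕ} {A : Matrix (Fin k) (Fin k) ℝ}
    (hA : IsMetric A) : (associated (R := ℝ) A.toQuadraticForm').SeparatingLeft := by
  have hs : ∀ x y, Matrix.toLinearMap₂' ℝ A x y = Matrix.toLinearMap₂' ℝ A y x := fun x y => by
    rw [Matrix.toLinearMap₂'_apply', Matrix.toLinearMap₂'_apply', Matrix.dotProduct_mulVec,
      ← Matrix.mulVec_transpose, hA.1.eq, dotProduct_comm]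
  have h : associated (R := ℝ) A.toQuadraticForm' = Matrix.toLinearMap₂' ℝ A :=
    associated_left_inverse ℝ hs
  rw [h]
  exact LinearMap.separatingLeft_toLinearMap₂'_of_det_ne_zero' hA.2

/-- A pseudo-Euclidean space of signature `(p, q)` has a frame with the prescribed Gram matrices
if their signatures add up to `(p, q)`. -/
theorem exists_isFrame (hη : IsMetric η) (hμ : IsMetric μ) (hs : SignatureSum p q η μ) :
    ∃ (t : Fin N → PseudoE p q) (n : Fin L → PseudoE p q), IsFrame η μ t n := by
  obtain ⟨w, hw, e⟩ := η.toQuadraticForm'.equivalent_one_neg_one_weighted_sum_squared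
    (separatingLeft_toQuadraticForm' hη)
  obtain ⟨w', hw', e'⟩ := μ.toQuadraticForm'.equivalent_one_neg_one_weighted_sum_squared
    (separatingLeft_toQuadraticForm' hμ)
  obtain ⟨hp, hq⟩ := hs
  rw [sigPos_of_equiv_weightedSumSquares e, sigPos_of_equiv_weightedSumSquares e',
    ← ncard_setOf_sumElim w w' (fun x => 0 < x)] at hp
  rw [sigNeg_of_equiv_weightedSumSquares e, sigNeg_of_equiv_weightedSumSquares e',
    ← ncard_setOf_sumElim w w' (fun x => x < 0)] at hq
  have h : Equivalent (η.toQuadraticForm'.prod μ.toQuadraticForm')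
      (weightedSumSquares ℝ (pseudoWeights p q)) := by
    obtain ⟨f⟩ := e
    obtain ⟨f'⟩ := e'
    refine (Equivalent.trans ⟨f.prod f'⟩ (weightedSumSquares_prod_equivalent w w')).trans
      (equivalent_pseudoWeights ?_ hp.symm hq.symm)
    rintro (k | k)
    · exact hw k
    · exact hw' k
  obtain ⟨Φ⟩ := h
  -- An isometry of quadratic forms preserves polar forms, so the images of the standard basis
  -- vectors have Gram matrix `diag(η, μ)`.
  have hΦ : ∀ x y, pseudoInner (Φ x) (Φ y) =
      polar (η.toQuadraticForm'.prod μ.toQuadraticForm') x y / 2 := by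
    intro x y
    have h1 : ∀ z, (η.toQuadraticForm'.prod μ.toQuadraticForm') z = pseudoInner (Φ z) (Φ z) :=
      fun z => by rw [← weightedSumSquares_pseudoWeights, Φ.map_app]
    have h2 : Φ (x + y) = Φ x + Φ y := map_add Φ.toLinearEquiv x y
    simp only [polar, h1, h2, pseudoInner_add_left, pseudoInner_add_right]
    rw [pseudoInner_comm (Φ y) (Φ x)]
    ring
  refine ⟨fun i => Φ (Pi.single i 1, 0), fun α => Φ (0, Pi.single α 1), ?_, ?_, ?_⟩
  · intro i j
    rw [hΦ]
    have : polar (η.toQuadraticForm'.prod μ.toQuadraticForm') (Pi.single i 1, 0)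
        (Pi.single j 1, 0) = polar η.toQuadraticForm' (Pi.single i 1) (Pi.single j 1) := by
      simp [polar, QuadraticMap.prod_apply]
    rw [this, polar_toQuadraticForm' hη.1]
    ring
  · intro α i
    rw [hΦ]
    simp [polar, QuadraticMap.prod_apply]
  · intro i j
    rw [hΦ]
    have : polar (η.toQuadraticForm'.prod μ.toQuadraticForm') (0, Pi.single i 1)
        (0, Pi.single j 1) = polar μ.toQuadraticForm' (Pi.single i 1) (Pi.single j 1) := by
      simp [polar, QuadraticMap.prod_apply]
    rw [this, polar_toQuadraticForm' hμ.1]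
    ring

end Signature

/-! ### From submanifolds to solutions: Gauss, Codazzi and Ricci equations in flat coordinates. -/

section StructureEquations

variable {N L p q : ℕ} {U : Set (Fin N → ℝ)} {η : Matrix (Fin N) (Fin N) ℝ}
  {μ : Matrix (Fin L) (Fin L) ℝ} {r : (Fin N → ℝ) → PseudoE p q}
  {n : Fin L → (Fin N → ℝ) → PseudoE p q} {u : Fin N → ℝ}

theorem pd_eq_zero_of_eqOn_const {E : Type} [NormedAddCommGroup E] [NormedSpace ℝ E]
    {f : (Fin N → ℝ) → E} {c : E} (hU : IsOpen U) (h : ∀ v ∈ U, f v = c) (hu : u ∈ U)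
    (i : Fin N) : pd i f u = 0 :=
  (pd_congr (g := fun _ => c) hU h hu).trans (pd_const c)

theorem IsFlatTorsionless.isFrame (h : IsFlatTorsionless U μ r n) (hu : u ∈ U) :
    IsFrame (firstForm r u) μ (fun i => pd i r u) (fun α => n α u) :=
  ⟨fun _ _ => rfl, h.normal u hu, h.gram u hu⟩

theorem IsFlatTorsionless.isMetric (h : IsFlatTorsionless U μ r n) (hpq : p + q = N + L)
    (hu : u ∈ U) : IsMetric (firstForm r u) ∧ IsMetric μ :=
  (h.isFrame hu).isMetric hpq (h.linearIndependent u hu)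

namespace IsFlatTorsionlessIn

theorem isFrame (h : IsFlatTorsionlessIn U η μ r n) (hu : u ∈ U) :
    IsFrame η μ (fun i => pd i r u) (fun α => n α u) :=
  h.2 u hu ▸ h.1.isFrame hu

theorem isMetric (h : IsFlatTorsionlessIn U η μ r n) (hpq : p + q = N + L) (hu : u ∈ U) :
    IsMetric η ∧ IsMetric μ :=
  h.2 u hu ▸ h.1.isMetric hpq hu

variable (hU : IsOpen U) (h : IsFlatTorsionlessIn U η μ r n)
include hU h

theorem contDiffOn_tangent (i : Fin N) : ContDiffOn ℝ ∞ (pd i r) U :=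
  contDiffOn_pd hU h.1.smooth_r i

/-- Koszul's argument: differentiate the constants `(r_{uⁱ}, r_{uʲ})` and combine three permutations
of the indices. In flat coordinates `r_{uⁱuʲ}` is therefore normal. -/
theorem pseudoInner_second_tangent (hu : u ∈ U) (i j k : Fin N) :
    pseudoInner (pd j (pd i r) u) (pd k r u) = 0 := by
  have hd : ∀ i, DifferentiableAt ℝ (pd i r) u := fun i =>
    differentiableAt_of_contDiffOn hU (h.contDiffOn_tangent hU i) hu
  have key : ∀ i j k, pseudoInner (pd k (pd i r) u) (pd j r u) +
      pseudoInner (pd i r u) (pd k (pd j r) u) = 0 := fun i j k => by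
    rw [← pd_pseudoInner (hd i) (hd j)]
    exact pd_eq_zero_of_eqOn_const hU (fun v hv => (h.isFrame hv).tangent i j) hu k
  have hs : ∀ i j, pd i (pd j r) u = pd j (pd i r) u := fun i j => pd_comm hU h.1.smooth_r hu
  have h1 := key i k j
  have h2 := key i j k
  have h3 := key j k i
  rw [pseudoInner_comm (pd i r u)] at h1 h2
  rw [pseudoInner_comm (pd j r u)] at h3
  rw [hs k j] at h2
  rw [hs i j, hs i k] at h3
  linarith

theorem pseudoInner_normal_deriv_tangent (hu : u ∈ U) (α : Fin L) (i k : Fin N) :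
    pseudoInner (pd k (n α) u) (pd i r u) = -secondForm r (n α) u i k := by
  have hn := differentiableAt_of_contDiffOn hU (h.1.smooth_n α) hu
  have hr := differentiableAt_of_contDiffOn hU (h.contDiffOn_tangent hU i) hu
  have := pd_pseudoInner (i := k) hn hr
  rw [pd_eq_zero_of_eqOn_const hU (fun v hv => (h.isFrame hv).normal α i) hu k] at this
  simp only [secondForm, Matrix.of_apply]
  linarith

theorem secondForm_symm (hu : u ∈ U) (α : Fin L) (i j : Fin N) :
    secondForm r (n α) u i j = secondForm r (n α) u j i := by
  simp only [secondForm, Matrix.of_apply]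
  rw [pd_comm hU h.1.smooth_r hu]

theorem contDiffOn_secondForm (α : Fin L) (i j : Fin N) :
    ContDiffOn ℝ ∞ (fun v => secondForm r (n α) v i j) U :=
  contDiffOn_pseudoInner (h.1.smooth_n α) (contDiffOn_pd hU (h.contDiffOn_tangent hU i) j)

/-- The Gauss formula in flat coordinates. -/
theorem pd_tangent (hpq : p + q = N + L) (hu : u ∈ U) (i k : Fin N) :
    pd k (pd i r) u = ∑ α, (∑ β, μ⁻¹ α β * secondForm r (n β) u i k) • n α u := by
  obtain ⟨hη, hμ⟩ := h.isMetric hpq hu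
  conv_lhs => rw [(h.isFrame hu).expand hη.2 hμ.2 hpq (pd k (pd i r) u)]
  simp only [h.pseudoInner_second_tangent hU hu, mul_zero, Finset.sum_const_zero, zero_smul,
    zero_add]
  refine Finset.sum_congr rfl fun α _ => ?_
  congr 1
  refine Finset.sum_congr rfl fun β _ => ?_
  rw [pseudoInner_comm]
  rfl

/-- The Weingarten formula in flat coordinates. -/
theorem pd_normal (hpq : p + q = N + L) (hu : u ∈ U) (α : Fin L) (k : Fin N) :
    pd k (n α) u = ∑ i, (∑ j, η⁻¹ i j * -secondForm r (n α) u j k) • pd i r u := by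
  obtain ⟨hη, hμ⟩ := h.isMetric hpq hu
  conv_lhs => rw [(h.isFrame hu).expand hη.2 hμ.2 hpq (pd k (n α) u)]
  have ht : ∀ β, pseudoInner (pd k (n α) u) (n β u) = 0 := fun β => h.1.torsionless u hu α β k
  simp only [ht, mul_zero, Finset.sum_const_zero, zero_smul, add_zero,
    h.pseudoInner_normal_deriv_tangent hU hu]

/-- In the derivative of `(n_α, r_{ij})` the term `(n_{α,k}, r_{ij})` vanishes, since `r_{ij}` is
normal and the torsion is zero. What is left, `(n_α, r_{ijk})`, is symmetric in `j` and `k`. -/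
theorem codazzi (hpq : p + q = N + L) (hu : u ∈ U) (α : Fin L) (i j k : Fin N) :
    pd k (fun v => secondForm r (n α) v i j) u = pd j (fun v => secondForm r (n α) v i k) u := by
  have hn := differentiableAt_of_contDiffOn hU (h.1.smooth_n α) hu
  have key : ∀ j k, pd k (fun v => secondForm r (n α) v i j) u =
      pseudoInner (n α u) (pd k (pd j (pd i r)) u) := fun j k => by
    have h1 : pd k (fun v => secondForm r (n α) v i j) u = _ :=
      pd_pseudoInner hn (differentiableAt_of_contDiffOn hU
        (contDiffOn_pd hU (h.contDiffOn_tangent hU i) j) hu)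
    have ht : ∀ β, pseudoInner (pd k (n α) u) (n β u) = 0 := fun β => h.1.torsionless u hu α β k
    rw [h1, h.pd_tangent hU hpq hu i j]
    simp [pseudoInner_sum_right, pseudoInner_smul_right, ht]
  rw [key, key, pd_comm hU (h.contDiffOn_tangent hU i) hu]

/-- Differentiating `(r_{ik}, r_j) = 0` gives `(r_{ik}, r_{jl}) = -(r_{ikl}, r_j)`, which is
symmetric in `k` and `l`. Expanding the product of the two normal vectors in the `n_α` gives the
equation. -/
theorem gauss (hpq : p + q = N + L) (hu : u ∈ U) (i j k l : Fin N) :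
    ∑ α, ∑ β, μ⁻¹ α β * (secondForm r (n α) u i k * secondForm r (n β) u j l -
      secondForm r (n α) u i l * secondForm r (n β) u j k) = 0 := by
  obtain ⟨hη, hμ⟩ := h.isMetric hpq hu
  have hd : ∀ i, DifferentiableAt ℝ (pd i r) u := fun i =>
    differentiableAt_of_contDiffOn hU (h.contDiffOn_tangent hU i) hu
  have key : ∀ k l, pseudoInner (pd l (pd k (pd i r)) u) (pd j r u) +
      pseudoInner (pd k (pd i r) u) (pd l (pd j r) u) = 0 := fun k l => by
    rw [← pd_pseudoInner (differentiableAt_of_contDiffOn hU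
      (contDiffOn_pd hU (h.contDiffOn_tangent hU i) k) hu) (hd j)]
    exact pd_eq_zero_of_eqOn_const hU
      (fun v hv => h.pseudoInner_second_tangent hU hv i k j) hu l
  have hexp : ∀ i k j l, pseudoInner (pd k (pd i r) u) (pd l (pd j r) u) =
      ∑ α, ∑ β, μ⁻¹ α β * (secondForm r (n α) u i k * secondForm r (n β) u j l) := by
    intro i k j l
    rw [(h.isFrame hu).pseudoInner_eq hη.2 hμ.2 hpq]
    simp only [h.pseudoInner_second_tangent hU hu, mul_zero, Finset.sum_const_zero, zero_add]
    refine Finset.sum_congr rfl fun α _ => Finset.sum_congr rfl fun β _ => ?_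
    rw [pseudoInner_comm _ (n α u), pseudoInner_comm _ (n β u)]
    rfl
  have h1 := key k l
  have h2 := key l k
  rw [pd_comm hU (h.contDiffOn_tangent hU i) hu] at h2
  simp only [mul_sub, Finset.sum_sub_distrib]
  rw [← hexp, ← hexp]
  linarith

/-- The dual of the Gauss argument: differentiate the vanishing torsion `(n_{α,k}, n_β)` and expand
the product of the tangent vectors `n_{α,k}`, `n_{β,l}` in the `r_{uⁱ}`. -/
theorem ricci (hpq : p + q = N + L) (hu : u ∈ U) (α β : Fin L) (k l : Fin N) :
    ∑ i, ∑ j, η⁻¹ i j * (secondForm r (n α) u i k * secondForm r (n β) u j l -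
      secondForm r (n α) u i l * secondForm r (n β) u j k) = 0 := by
  obtain ⟨hη, hμ⟩ := h.isMetric hpq hu
  have hd : ∀ α, DifferentiableAt ℝ (n α) u := fun α =>
    differentiableAt_of_contDiffOn hU (h.1.smooth_n α) hu
  have key : ∀ k l, pseudoInner (pd l (pd k (n α)) u) (n β u) +
      pseudoInner (pd k (n α) u) (pd l (n β) u) = 0 := fun k l => by
    rw [← pd_pseudoInner (differentiableAt_of_contDiffOn hU
      (contDiffOn_pd hU (h.1.smooth_n α) k) hu) (hd β)]
    exact pd_eq_zero_of_eqOn_const hU (fun v hv => h.1.torsionless v hv α β k) hu l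
  have ht : ∀ α β k, pseudoInner (pd k (n α) u) (n β u) = 0 :=
    fun α β k => h.1.torsionless u hu α β k
  have hexp : ∀ k l, pseudoInner (pd k (n α) u) (pd l (n β) u) =
      ∑ i, ∑ j, η⁻¹ i j * (secondForm r (n α) u i k * secondForm r (n β) u j l) := by
    intro k l
    rw [(h.isFrame hu).pseudoInner_eq hη.2 hμ.2 hpq]
    simp only [ht, mul_zero, Finset.sum_const_zero, add_zero,
      h.pseudoInner_normal_deriv_tangent hU hu, neg_mul_neg]
  have h1 := key k l
  have h2 := key l k
  rw [pd_comm hU (h.1.smooth_n α) hu] at h2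
  simp only [mul_sub, Finset.sum_sub_distrib]
  rw [← hexp, ← hexp]
  linarith

/-- Codazzi closes each row of `ω_α`, giving potentials `f α i`; symmetry of `ω_α` closes the
one-form with coefficients `f α i`, giving `ψ α`. -/
theorem exists_hessian_potentials (hUs : IsSimplyConnected U) (hpq : p + q = N + L) :
    ∃ ψ : Fin L → (Fin N → ℝ) → ℝ, (∀ α, ContDiffOn ℝ ∞ (ψ α) U) ∧ HasHessianForms U r n ψ := by
  have h1 : ∀ α i, ∃ f : (Fin N → ℝ) → ℝ, ContDiffOn ℝ ∞ f U ∧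
      ∀ u ∈ U, ∀ j, pd j f u = secondForm r (n α) u i j := fun α i =>
    exists_potential hU hUs (h.contDiffOn_secondForm hU α i)
      (fun u hu j k => h.codazzi hU hpq hu α i j k)
  choose f hf hfp using h1
  have h2 : ∀ α, ∃ ψ : (Fin N → ℝ) → ℝ, ContDiffOn ℝ ∞ ψ U ∧
      ∀ u ∈ U, ∀ i, pd i ψ u = f α i u := fun α =>
    exists_potential hU hUs (hf α) (fun u hu i j => by
      rw [hfp α i u hu j, hfp α j u hu i, h.secondForm_symm hU hu])
  choose ψ hψ hψp using h2
  refine ⟨ψ, hψ, fun u hu α => ?_⟩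
  ext i j
  rw [← hfp α i u hu j]
  exact (pd_congr hU (fun v hv => hψp α v hv i) hu).symm

theorem isSolution_of_hasHessianForms (hpq : p + q = N + L) {ψ : Fin L → (Fin N → ℝ) → ℝ}
    (hψ : ∀ α, ContDiffOn ℝ ∞ (ψ α) U) (hH : HasHessianForms U r n ψ) : IsSolution U η μ ψ := by
  refine ⟨hψ, fun u hu i j k l => ?_, fun u hu α β k l => ?_⟩
  · simp only [← hH u hu]
    exact h.gauss hU hpq hu i j k l
  · simp only [← hH u hu]
    exact h.ricci hU hpq hu α β k l

end IsFlatTorsionlessIn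

/-- Two functions have the same Hessian on a connected open set exactly if they differ by an
affine function. -/
theorem hessian_eq_iff (hU : IsOpen U) (hc : IsConnected U) {f g : (Fin N → ℝ) → ℝ}
    (hf : ContDiffOn ℝ ∞ f U) :
    (ContDiffOn ℝ ∞ g U ∧ ∀ u ∈ U, hessian g u = hessian f u) ↔
      ∃ (a : Fin N → ℝ) (c : ℝ), ∀ u ∈ U, g u = f u + ∑ i, a i * u i + c := by
  have hlin : ∀ (a : Fin N → ℝ) (c : ℝ),
      ContDiff ℝ ∞ fun v : Fin N → ℝ => ∑ i, a i * v i + c := fun a c => by fun_prop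
  have hpdlin : ∀ (a : Fin N → ℝ) (c : ℝ) (v : Fin N → ℝ) (k : Fin N),
      pd k (fun v : Fin N → ℝ => ∑ i, a i * v i + c) v = a k := fun a c v k => by
    rw [pd_add (by fun_prop) (by fun_prop), pd_sum (fun i _ => by fun_prop), pd_const, add_zero]
    have : ∀ i, pd k (fun v : Fin N → ℝ => a i * v i) v = a i * if k = i then 1 else 0 :=
      fun i => by rw [pd_const_mul _ (by fun_prop), pd_coord]
    simp [this]
  constructor
  · rintro ⟨hg, hH⟩
    obtain ⟨u₀, hu₀⟩ := hc.nonempty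
    have hd : ∀ {f : (Fin N → ℝ) → ℝ}, ContDiffOn ℝ ∞ f U → ∀ v ∈ U, DifferentiableAt ℝ f v :=
      fun hf v hv => differentiableAt_of_contDiffOn hU hf hv
    have h1 : ∀ i, ∀ v ∈ U, pd i g v - pd i f v = pd i g u₀ - pd i f u₀ := fun i v hv =>
      eq_of_pd_eq_zero (f := fun v => pd i g v - pd i f v) hU hc.isPreconnected
        (fun w hw => (hd (contDiffOn_pd hU hg i) w hw).sub (hd (contDiffOn_pd hU hf i) w hw))
        (fun w hw j => by
          rw [pd_sub (hd (contDiffOn_pd hU hg i) w hw) (hd (contDiffOn_pd hU hf i) w hw)]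
          exact sub_eq_zero.2 (congrFun (congrFun (hH w hw) i) j)) hu₀ hv
    -- Equal Hessians make the difference of the gradients constant; its value at `u₀` is the linear
    -- part.
    set a : Fin N → ℝ := fun i => pd i g u₀ - pd i f u₀ with ha
    refine ⟨a, g u₀ - f u₀ - ∑ i, a i * u₀ i, fun v hv => ?_⟩
    have hl : ∀ w, DifferentiableAt ℝ (fun v : Fin N → ℝ => ∑ i, a i * v i + 0) w := fun w => by
      fun_prop
    have h2 := eq_of_pd_eq_zero (f := fun v => g v - f v - (∑ i, a i * v i + 0)) hU
      hc.isPreconnected (fun w hw => ((hd hg w hw).sub (hd hf w hw)).sub (hl w))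
      (fun w hw j => by
        rw [pd_sub (f := fun v => g v - f v) ((hd hg w hw).sub (hd hf w hw)) (hl w),
          pd_sub (hd hg w hw) (hd hf w hw),
          hpdlin, h1 j w hw, sub_self]) hu₀ hv
    simp only [add_zero] at h2
    linarith
  · rintro ⟨a, c, h⟩
    have h' : EqOn g (fun v => f v + (∑ i, a i * v i + c)) U := fun v hv => by
      rw [h v hv, add_assoc]
    refine ⟨(hf.add (hlin a c).contDiffOn).congr h', fun u hu => ?_⟩
    ext i j
    refine pd_congr hU (g := fun v => pd i f v + a i) (fun v hv => ?_) hu |>.trans ?_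
    · rw [pd_congr hU h' hv, pd_add (differentiableAt_of_contDiffOn hU hf hv)
        ((hlin a c).differentiable (by simp) v), hpdlin]
    · rw [pd_add (differentiableAt_of_contDiffOn hU (contDiffOn_pd hU hf i) hu)
        (differentiableAt_const _), pd_const, add_zero]
      rfl

/-- A flat torsionless submanifold in flat coordinates gives a solution of the Gauss and Ricci
equations, unique up to affine functions. -/
theorem exists_solution_of_isFlatTorsionlessIn (hpq : p + q = N + L) (hU : IsOpen U)
    (hUs : IsSimplyConnected U) (h : IsFlatTorsionlessIn U η μ r n) :
    IsMetric η ∧ IsMetric μ ∧ SignatureSum p q η μ ∧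
      ∃ ψ : Fin L → (Fin N → ℝ) → ℝ, IsSolution U η μ ψ ∧ HasHessianForms U r n ψ ∧
        ∀ ψ' : Fin L → (Fin N → ℝ) → ℝ, (IsSolution U η μ ψ' ∧ HasHessianForms U r n ψ') ↔
          ∃ (a : Fin L → Fin N → ℝ) (c : Fin L → ℝ),
            ∀ u ∈ U, ∀ α, ψ' α u = ψ α u + ∑ i, a α i * u i + c α := by
  obtain ⟨u₀, hu₀⟩ := hUs.nonempty
  obtain ⟨hη, hμ⟩ := h.isMetric hpq hu₀
  obtain ⟨ψ, hψ, hH⟩ := h.exists_hessian_potentials hU hUs hpq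
  have hc : IsConnected U := hUs.isPathConnected.isConnected
  refine ⟨hη, hμ, (h.isFrame hu₀).signatureSum hη.2 hμ.2 hpq, ψ,
    h.isSolution_of_hasHessianForms hU hpq hψ hH, hH, fun ψ' => ⟨?_, ?_⟩⟩
  · rintro ⟨hs, hH'⟩
    have h1 := fun α => (hessian_eq_iff hU hc (hψ α)).1
      ⟨hs.1 α, fun u hu => (hH' u hu α).symm.trans (hH u hu α)⟩
    choose a c hac using h1
    exact ⟨a, c, fun u hu α => hac α u hu⟩
  · rintro ⟨a, c, hac⟩
    have h1 := fun α => (hessian_eq_iff hU hc (hψ α)).2 ⟨a α, c α, fun u hu => hac u hu α⟩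
    have hH' : HasHessianForms U r n ψ' := fun u hu α =>
      (hH u hu α).trans ((h1 α).2 u hu).symm
    exact ⟨h.isSolution_of_hasHessianForms hU hpq (fun α => (h1 α).1) hH', hH'⟩

end StructureEquations

/-! ### Vector-valued versions, component by component. -/

section VectorValued

variable {N : ℕ} {ι κ : Type} [Fintype ι] [DecidableEq ι] [Fintype κ] {U : Set (Fin N → ℝ)}

theorem exists_linear_system_solution_pi (hU : IsOpen U) (hUs : IsSimplyConnected U)
    {a : Fin N → ι → ι → (Fin N → ℝ) → ℝ} (ha : ∀ i c d, ContDiffOn ℝ ∞ (a i c d) U)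
    (h : ∀ u ∈ U, ∀ i j c d, pd j (a i c d) u + ∑ e, a i c e u * a j e d u =
      pd i (a j c d) u + ∑ e, a j c e u * a i e d u)
    {u₀ : Fin N → ℝ} (hu₀ : u₀ ∈ U) (y₀ : ι → κ → ℝ) :
    ∃ Y : ι → (Fin N → ℝ) → κ → ℝ, (∀ c, ContDiffOn ℝ ∞ (Y c) U) ∧ (∀ c, Y c u₀ = y₀ c) ∧
      ∀ u ∈ U, ∀ i c, pd i (Y c) u = ∑ d, a i c d u • Y d u := by
  have h1 := fun e : κ => exists_linear_system_solution hU hUs ha h hu₀ (fun c => y₀ c e)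
  choose Y hYs hY0 hY using h1
  have hs : ∀ c, ContDiffOn ℝ ∞ (fun v e => Y e c v) U := fun c =>
    contDiffOn_pi.2 fun e => hYs e c
  refine ⟨fun c v e => Y e c v, hs, fun c => funext fun e => hY0 e c, fun u hu i c => ?_⟩
  ext e
  rw [pd_apply (differentiableAt_of_contDiffOn hU (hs c) hu), hY e u hu]
  simp

theorem linear_system_solution_unique_pi (hU : IsOpen U) (hc : IsPreconnected U)
    {a : Fin N → ι → ι → (Fin N → ℝ) → ℝ} (ha : ∀ i c d, ContDiffOn ℝ ∞ (a i c d) U)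
    {Y Z : ι → (Fin N → ℝ) → κ → ℝ} (hYs : ∀ c, ContDiffOn ℝ ∞ (Y c) U)
    (hZs : ∀ c, ContDiffOn ℝ ∞ (Z c) U)
    (hY : ∀ u ∈ U, ∀ i c, pd i (Y c) u = ∑ d, a i c d u • Y d u)
    (hZ : ∀ u ∈ U, ∀ i c, pd i (Z c) u = ∑ d, a i c d u • Z d u)
    {u₀ : Fin N → ℝ} (hu₀ : u₀ ∈ U) (h₀ : ∀ c, Y c u₀ = Z c u₀) {u : Fin N → ℝ} (hu : u ∈ U)
    (c : ι) : Y c u = Z c u := by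
  ext e
  have hcomp : ∀ {Y : ι → (Fin N → ℝ) → κ → ℝ}, (∀ c, ContDiffOn ℝ ∞ (Y c) U) →
      (∀ u ∈ U, ∀ i c, pd i (Y c) u = ∑ d, a i c d u • Y d u) →
      ∀ u ∈ U, ∀ i c, pd i (fun v => Y c v e) u = ∑ d, a i c d u * Y d u e :=
    fun hYs hY u hu i c => by
      rw [← pd_apply (differentiableAt_of_contDiffOn hU (hYs c) hu), hY u hu]
      simp
  exact linear_system_solution_unique hU hc ha (Y := fun c v => Y c v e) (Z := fun c v => Z c v e)
    (fun c => contDiffOn_pi.1 (hYs c) e) (fun c => contDiffOn_pi.1 (hZs c) e) (hcomp hYs hY)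
    (hcomp hZs hZ) hu₀ (fun c => congrFun (h₀ c) e) hu c

theorem exists_potential_pi (hU : IsOpen U) (hUs : IsSimplyConnected U)
    {f : Fin N → (Fin N → ℝ) → κ → ℝ} (hf : ∀ i, ContDiffOn ℝ ∞ (f i) U)
    (h : ∀ u ∈ U, ∀ i j, pd j (f i) u = pd i (f j) u) :
    ∃ ψ : (Fin N → ℝ) → κ → ℝ, ContDiffOn ℝ ∞ ψ U ∧ ∀ u ∈ U, ∀ i, pd i ψ u = f i u := by
  have h1 : ∀ e, ∃ ψ : (Fin N → ℝ) → ℝ, ContDiffOn ℝ ∞ ψ U ∧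
      ∀ u ∈ U, ∀ i, pd i ψ u = f i u e := fun e =>
    exists_potential hU hUs (fun i => contDiffOn_pi.1 (hf i) e) fun u hu i j => by
      rw [← pd_apply (differentiableAt_of_contDiffOn hU (hf i) hu),
        ← pd_apply (differentiableAt_of_contDiffOn hU (hf j) hu), h u hu]
  choose ψ hψs hψ using h1
  have hs : ContDiffOn ℝ ∞ (fun v e => ψ e v) U := contDiffOn_pi.2 hψs
  refine ⟨fun v e => ψ e v, hs, fun u hu i => ?_⟩
  ext e
  rw [pd_apply (differentiableAt_of_contDiffOn hU hs hu), hψ e u hu]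

end VectorValued

/-! ### From solutions to submanifolds, and uniqueness up to motions. -/

section Reconstruction

variable {N L p q : ℕ} {U : Set (Fin N → ℝ)} {η : Matrix (Fin N) (Fin N) ℝ}
  {μ : Matrix (Fin L) (Fin L) ℝ} {ψ : Fin L → (Fin N → ℝ) → ℝ}

theorem IsMetric.sum_inv_mul {k : ℕ} {M : Matrix (Fin k) (Fin k) ℝ} (hM : IsMetric M)
    (v : Fin k → ℝ) (b : Fin k) : ∑ c, (∑ a, M⁻¹ c a * v a) * M c b = v b := by
  have h : M.mulVec (M⁻¹.mulVec v) = v := by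
    rw [Matrix.mulVec_mulVec, Matrix.mul_nonsing_inv _ (isUnit_iff_ne_zero.2 hM.2),
      Matrix.one_mulVec]
  rw [← congrFun h b]
  simp only [Matrix.mulVec, dotProduct]
  refine Finset.sum_congr rfl fun c _ => ?_
  rw [hM.1.apply b c, mul_comm]

/-- The coefficients of the Gauss and Weingarten formulas of the frame `(r_{uⁱ}, n_α)`. -/
noncomputable def frameCoeff (η : Matrix (Fin N) (Fin N) ℝ) (μ : Matrix (Fin L) (Fin L) ℝ)
    (ψ : Fin L → (Fin N → ℝ) → ℝ) (k : Fin N) :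
    Fin N ⊕ Fin L → Fin N ⊕ Fin L → (Fin N → ℝ) → ℝ
  | .inl i, .inr α => fun u => ∑ β, μ⁻¹ α β * hessian (ψ β) u i k
  | .inr α, .inl i => fun u => ∑ j, η⁻¹ i j * -hessian (ψ α) u j k
  | .inl _, .inl _ => fun _ => 0
  | .inr _, .inr _ => fun _ => 0

theorem contDiffOn_hessian (hU : IsOpen U) {f : (Fin N → ℝ) → ℝ} (hf : ContDiffOn ℝ ∞ f U)
    (i j : Fin N) : ContDiffOn ℝ ∞ (fun v => hessian f v i j) U :=
  contDiffOn_pd hU (contDiffOn_pd hU hf i) j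

theorem hessian_symm (hU : IsOpen U) {f : (Fin N → ℝ) → ℝ} (hf : ContDiffOn ℝ ∞ f U)
    {u : Fin N → ℝ} (hu : u ∈ U) (i j : Fin N) : hessian f u i j = hessian f u j i := by
  simp only [hessian, Matrix.of_apply]
  rw [pd_comm hU hf hu]

theorem contDiffOn_frameCoeff (hU : IsOpen U) (hψ : ∀ α, ContDiffOn ℝ ∞ (ψ α) U) (k : Fin N)
    (c d : Fin N ⊕ Fin L) : ContDiffOn ℝ ∞ (frameCoeff η μ ψ k c d) U := by
  rcases c with i | α <;> rcases d with j | β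
  · exact contDiffOn_const
  · exact ContDiffOn.sum fun γ _ => contDiffOn_const.mul (contDiffOn_hessian hU (hψ γ) i k)
  · exact ContDiffOn.sum fun γ _ => contDiffOn_const.mul (contDiffOn_hessian hU (hψ α) γ k).neg
  · exact contDiffOn_const

/-- Integrability of the frame system splits into blocks: tangent–tangent is Gauss, normal–normal is
Ricci, and the mixed blocks are Codazzi, which for Hessians is the symmetry of third derivatives. -/
theorem frameCoeff_compat (hU : IsOpen U) (hs : IsSolution U η μ ψ) {u : Fin N → ℝ} (hu : u ∈ U)
    (k l : Fin N) (c d : Fin N ⊕ Fin L) :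
    pd l (frameCoeff η μ ψ k c d) u + ∑ e, frameCoeff η μ ψ k c e u * frameCoeff η μ ψ l e d u =
      pd k (frameCoeff η μ ψ l c d) u +
        ∑ e, frameCoeff η μ ψ l c e u * frameCoeff η μ ψ k e d u := by
  obtain ⟨hψ, hG, hR⟩ := hs
  have hH : ∀ α i j, DifferentiableAt ℝ (fun v => hessian (ψ α) v i j) u := fun α i j =>
    differentiableAt_of_contDiffOn hU (contDiffOn_hessian hU (hψ α) i j) hu
  have hHc : ∀ α i k l, pd l (fun v => hessian (ψ α) v i k) u =
      pd k (fun v => hessian (ψ α) v i l) u := fun α i k l =>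
    pd_comm hU (contDiffOn_pd hU (hψ α) i) hu
  rcases c with i | α <;> rcases d with j | β
  · simp only [frameCoeff, pd_const, zero_add, Fintype.sum_sum_type, zero_mul,
      Finset.sum_const_zero]
    have h1 : ∀ k l, ∑ γ, (∑ β, μ⁻¹ γ β * hessian (ψ β) u i k) *
        ∑ m, η⁻¹ j m * -hessian (ψ γ) u m l =
        -∑ m, η⁻¹ j m * ∑ γ, ∑ β, μ⁻¹ γ β * (hessian (ψ γ) u m l * hessian (ψ β) u i k) := by
      intro k l
      simp_rw [Finset.sum_mul_sum]
      simp only [Finset.mul_sum, ← Finset.sum_neg_distrib]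
      refine (Finset.sum_congr rfl fun _ _ => Finset.sum_comm).trans ?_
      rw [Finset.sum_comm]
      exact Finset.sum_congr rfl fun _ _ => Finset.sum_congr rfl fun _ _ =>
        Finset.sum_congr rfl fun _ _ => by ring
    rw [h1, h1]
    congr 1
    refine Finset.sum_congr rfl fun m _ => ?_
    congr 1
    have := hG u hu m i l k
    simp only [mul_sub, Finset.sum_sub_distrib] at this
    exact sub_eq_zero.1 this
  · simp only [frameCoeff, Fintype.sum_sum_type, zero_mul, mul_zero, Finset.sum_const_zero,
      add_zero]
    rw [pd_sum fun γ _ => (hH γ i k).const_mul _, pd_sum fun γ _ => (hH γ i l).const_mul _]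
    refine Finset.sum_congr rfl fun γ _ => ?_
    rw [pd_const_mul _ (hH γ i k), pd_const_mul _ (hH γ i l), hHc]
  · simp only [frameCoeff, Fintype.sum_sum_type, zero_mul, mul_zero, Finset.sum_const_zero,
      add_zero, mul_neg, ← neg_mul]
    rw [pd_sum fun γ _ => (hH α γ k).const_mul _, pd_sum fun γ _ => (hH α γ l).const_mul _]
    refine Finset.sum_congr rfl fun γ _ => ?_
    rw [pd_const_mul _ (hH α γ k), pd_const_mul _ (hH α γ l), hHc]
  · simp only [frameCoeff, pd_const, zero_add, Fintype.sum_sum_type, zero_mul,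
      Finset.sum_const_zero, add_zero]
    have h1 : ∀ k l, ∑ i, (∑ j, η⁻¹ i j * -hessian (ψ α) u j k) *
        ∑ γ, μ⁻¹ β γ * hessian (ψ γ) u i l =
        -∑ γ, μ⁻¹ β γ * ∑ i, ∑ j, η⁻¹ i j * (hessian (ψ γ) u i l * hessian (ψ α) u j k) := by
      intro k l
      simp_rw [Finset.sum_mul_sum]
      simp only [Finset.mul_sum, ← Finset.sum_neg_distrib]
      refine (Finset.sum_congr rfl fun _ _ => Finset.sum_comm).trans ?_
      rw [Finset.sum_comm]
      exact Finset.sum_congr rfl fun _ _ => Finset.sum_congr rfl fun _ _ =>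
        Finset.sum_congr rfl fun _ _ => by ring
    rw [h1, h1]
    congr 1
    refine Finset.sum_congr rfl fun γ _ => ?_
    congr 1
    have := hR u hu γ α l k
    simp only [mul_sub, Finset.sum_sub_distrib] at this
    exact sub_eq_zero.1 this

/-- The coefficients are infinitesimal isometries of `diag(η, μ)`: in the mixed blocks the Gauss and
Weingarten terms are the same Hessian entry with opposite signs. So the constant matrix solves the
system of Gram matrices. -/
theorem frameCoeff_gram (hη : IsMetric η) (hμ : IsMetric μ) (k : Fin N)
    (c d : Fin N ⊕ Fin L) (u : Fin N → ℝ) :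
    ∑ e, frameCoeff η μ ψ k c e u * Matrix.fromBlocks η 0 0 μ e d +
      ∑ e, frameCoeff η μ ψ k d e u * Matrix.fromBlocks η 0 0 μ c e = 0 := by
  have key : ∀ i β, ∑ γ, (∑ α, μ⁻¹ γ α * hessian (ψ α) u i k) * μ γ β +
      ∑ j, (∑ m, η⁻¹ j m * -hessian (ψ β) u m k) * η j i = 0 := fun i β => by
    rw [hμ.sum_inv_mul, hη.sum_inv_mul]
    ring
  rcases c with i | α <;> rcases d with j | β
  · simp [frameCoeff, Fintype.sum_sum_type]
  · simp only [frameCoeff, Fintype.sum_sum_type, Matrix.fromBlocks_apply₁₁,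
      Matrix.fromBlocks_apply₁₂, Matrix.fromBlocks_apply₂₂, Matrix.zero_apply, mul_zero,
      Finset.sum_const_zero, zero_add, add_zero]
    simp only [hη.1.apply _ i]
    exact key i β
  · simp only [frameCoeff, Fintype.sum_sum_type, Matrix.fromBlocks_apply₁₁,
      Matrix.fromBlocks_apply₂₁, Matrix.fromBlocks_apply₂₂, Matrix.zero_apply, mul_zero,
      Finset.sum_const_zero, zero_add, add_zero]
    simp only [hμ.1.apply _ α]
    rw [add_comm]
    exact key j α
  · simp [frameCoeff, Fintype.sum_sum_type]

theorem riemann_eq_zero_of_const {g : (Fin N → ℝ) → Matrix (Fin N) (Fin N) ℝ} (hU : IsOpen U)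
    (h : ∀ v ∈ U, g v = η) {u : Fin N → ℝ} (hu : u ∈ U) (l k i j : Fin N) :
    riemann g l k i j u = 0 := by
  have h1 : ∀ v ∈ U, ∀ i j k, pd k (fun v => g v i j) v = 0 := fun v hv i j k =>
    pd_eq_zero_of_eqOn_const hU (c := η i j) (fun w hw => by rw [h w hw]) hv k
  have h2 : ∀ v ∈ U, ∀ k i j, christoffel g k i j v = 0 := fun v hv k i j => by
    simp [christoffel, h1 v hv]
  have h3 : ∀ k i j m, pd m (christoffel g k i j) u = 0 := fun k i j m =>
    pd_eq_zero_of_eqOn_const hU (fun v hv => h2 v hv k i j) hu m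
  simp [riemann, h2 u hu, h3]

theorem frame_system {r : (Fin N → ℝ) → PseudoE p q} {n : Fin L → (Fin N → ℝ) → PseudoE p q}
    (hpq : p + q = N + L) (hU : IsOpen U) (h : IsFlatTorsionlessIn U η μ r n)
    (hH : HasHessianForms U r n ψ) {u : Fin N → ℝ} (hu : u ∈ U) (k : Fin N)
    (c : Fin N ⊕ Fin L) :
    pd k ((Sum.elim (fun i => pd i r) n : Fin N ⊕ Fin L → (Fin N → ℝ) → PseudoE p q) c) u =
      ∑ d, frameCoeff η μ ψ k c d u •
        (Sum.elim (fun i => pd i r) n : Fin N ⊕ Fin L → (Fin N → ℝ) → PseudoE p q) d u := by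
  rcases c with i | α
  · simp only [Sum.elim_inl, h.pd_tangent hU hpq hu, Fintype.sum_sum_type, frameCoeff, zero_smul,
      Finset.sum_const_zero, zero_add, Sum.elim_inr, hH u hu]
  · simp only [Sum.elim_inl, h.pd_normal hU hpq hu, Fintype.sum_sum_type, frameCoeff, zero_smul,
      Finset.sum_const_zero, add_zero, Sum.elim_inr, hH u hu]

/-- Two flat torsionless submanifolds in flat coordinates with the same fundamental forms are
congruent. -/
theorem congruent_of_hasHessianForms (hpq : p + q = N + L) (hU : IsOpen U) (hc : IsConnected U)
    (hψ : ∀ α, ContDiffOn ℝ ∞ (ψ α) U) {r r' : (Fin N → ℝ) → PseudoE p q}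
    {n n' : Fin L → (Fin N → ℝ) → PseudoE p q} (h : IsFlatTorsionlessIn U η μ r n)
    (hH : HasHessianForms U r n ψ) (h' : IsFlatTorsionlessIn U η μ r' n')
    (hH' : HasHessianForms U r' n' ψ) : Congruent U r r' n n' := by
  obtain ⟨u₀, hu₀⟩ := hc.nonempty
  obtain ⟨hη, hμ⟩ := h.isMetric hpq hu₀
  have hF := h.isFrame hu₀
  have hF' := h'.isFrame hu₀
  have hli := hF.linearIndependent hη.2 hμ.2
  have hli' := hF'.linearIndependent hη.2 hμ.2
  let b : Module.Basis (Fin N ⊕ Fin L) ℝ (PseudoE p q) :=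
    Module.Basis.mk hli (span_eq_top_of_card hli (by simp [hpq])).ge
  let b' : Module.Basis (Fin N ⊕ Fin L) ℝ (PseudoE p q) :=
    Module.Basis.mk hli' (span_eq_top_of_card hli' (by simp [hpq])).ge
  -- `T` carries the first frame at `u₀` to the second; it is an isometry because the two Gram
  -- matrices agree.
  let T := b.equiv b' (Equiv.refl _)
  have hTb : ∀ c, T (Sum.elim (fun i => pd i r u₀) (fun α => n α u₀) c) =
      Sum.elim (fun i => pd i r' u₀) (fun α => n' α u₀) c := fun c => by
    have : T (b c) = b' c := by simp [T]
    simpa [b, b'] using this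
  have hT : ∀ x y, pseudoInner (T x) (T y) = pseudoInner x y := by
    have : (pseudoBilin p q).compl₁₂ T.toLinearMap T.toLinearMap = pseudoBilin p q := by
      refine b.ext fun c => b.ext fun d => ?_
      have e1 : ∀ c, b c = Sum.elim (fun i => pd i r u₀) (fun α => n α u₀) c := fun c => by
        simp [b]
      rw [LinearMap.compl₁₂_apply, pseudoBilin_apply, pseudoBilin_apply, e1, e1]
      change pseudoInner (T _) (T _) = _
      rw [hTb, hTb, hF.gram_elim, hF'.gram_elim]
    intro x y
    exact congrArg (fun B => B x y) this
  let T' : PseudoE p q →L[ℝ] PseudoE p q := T.toContinuousLinearEquiv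
  have hT' : ∀ x, T' x = T x := fun _ => rfl
  have hsm : ∀ {r : (Fin N → ℝ) → PseudoE p q} {n : Fin L → (Fin N → ℝ) → PseudoE p q},
      IsFlatTorsionlessIn U η μ r n → ∀ c, ContDiffOn ℝ ∞
        ((Sum.elim (fun i => pd i r) n : Fin N ⊕ Fin L → (Fin N → ℝ) → PseudoE p q) c) U := by
    rintro r n h (i | α)
    · exact h.contDiffOn_tangent hU i
    · exact h.1.smooth_n α
  -- The `T`-image of the first frame and the second frame solve the same linear system with the
  -- same value at `u₀`.
  have hframe : ∀ u ∈ U, ∀ c, T ((Sum.elim (fun i => pd i r) n :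
      Fin N ⊕ Fin L → (Fin N → ℝ) → PseudoE p q) c u) =
      (Sum.elim (fun i => pd i r') n' : Fin N ⊕ Fin L → (Fin N → ℝ) → PseudoE p q) c u := by
    intro u hu c
    refine linear_system_solution_unique_pi (κ := Fin p ⊕ Fin q) hU hc.isPreconnected
      (a := frameCoeff η μ ψ) (fun k c d => contDiffOn_frameCoeff hU hψ k c d)
      (Y := fun c v => T' ((Sum.elim (fun i => pd i r) n :
        Fin N ⊕ Fin L → (Fin N → ℝ) → PseudoE p q) c v))
      (Z := (Sum.elim (fun i => pd i r') n' : Fin N ⊕ Fin L → (Fin N → ℝ) → PseudoE p q))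
      (fun c => T'.contDiff.comp_contDiffOn (hsm h c)) (hsm h') (fun v hv k c => ?_)
      (fun v hv k c => frame_system hpq hU h' hH' hv k c) hu₀ (fun c => ?_) hu c
    · rw [pd_clm T' (differentiableAt_of_contDiffOn hU (hsm h c) hv),
        frame_system hpq hU h hH hv k c]
      simp only [map_sum, map_smul]
    · rw [hT']
      rcases c with i | α
      · exact hTb (Sum.inl i)
      · exact hTb (Sum.inr α)
  have hr : ∀ u ∈ U, DifferentiableAt ℝ r u := fun u hu =>
    differentiableAt_of_contDiffOn hU h.1.smooth_r hu
  have hr' : ∀ u ∈ U, DifferentiableAt ℝ r' u := fun u hu =>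
    differentiableAt_of_contDiffOn hU h'.1.smooth_r hu
  have hTr : ∀ u ∈ U, DifferentiableAt ℝ (fun v => T' (r v)) u := fun u hu =>
    T'.differentiableAt.comp u (hr u hu)
  refine ⟨T, r' u₀ - T (r u₀), hT, fun u hu => ⟨?_, fun α => (hframe u hu (Sum.inr α)).symm⟩⟩
  have h1 := eq_of_pd_eq_zero (f := fun v => r' v - T' (r v)) hU hc.isPreconnected
    (fun v hv => (hr' v hv).sub (hTr v hv)) (fun v hv i => by
      rw [pd_sub (hr' v hv) (hTr v hv), pd_clm T' (hr v hv)]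
      exact sub_eq_zero.2 (hframe v hv (Sum.inl i)).symm) hu₀ hu
  rw [← hT' (r u₀), ← h1, ← hT' (r u)]
  abel

/-- Each solution of the Gauss and Ricci equations on a simply connected open set belongs to a
flat torsionless submanifold. -/
theorem exists_isFlatTorsionlessIn (hU : IsOpen U) (hUs : IsSimplyConnected U)
    (hη : IsMetric η) (hμ : IsMetric μ) (hsig : SignatureSum p q η μ) (hs : IsSolution U η μ ψ) :
    ∃ (r : (Fin N → ℝ) → PseudoE p q) (n : Fin L → (Fin N → ℝ) → PseudoE p q),
      IsFlatTorsionlessIn U η μ r n ∧ HasHessianForms U r n ψ := by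
  obtain ⟨u₀, hu₀⟩ := hUs.nonempty
  have hc : IsConnected U := hUs.isPathConnected.isConnected
  obtain ⟨t, m, hF⟩ := exists_isFrame (p := p) (q := q) hη hμ hsig
  have ha := contDiffOn_frameCoeff (η := η) (μ := μ) hU hs.1
  obtain ⟨f, hfs, hf0, hf⟩ := exists_linear_system_solution_pi (κ := Fin p ⊕ Fin q) hU hUs ha
    (fun u hu k l c d => frameCoeff_compat hU hs hu k l c d) hu₀ (Sum.elim t m)
  have hfd : ∀ u ∈ U, ∀ c, DifferentiableAt ℝ (f c) u := fun u hu c =>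
    differentiableAt_of_contDiffOn hU (hfs c) hu
  -- The Gram matrix of the frame and the constant `diag(η, μ)` solve the same bilinear system and
  -- agree at `u₀`.
  have hgram : ∀ u ∈ U, ∀ c d, pseudoInner (f c u) (f d u) = Matrix.fromBlocks η 0 0 μ c d :=
    fun u hu c d => bilinear_system_solution_unique hU hc.isPreconnected ha
      (S := fun c d v => pseudoInner (f c v) (f d v))
      (S' := fun c d _ => Matrix.fromBlocks η 0 0 μ c d)
      (fun c d => contDiffOn_pseudoInner (hfs c) (hfs d)) (fun c d => contDiffOn_const)
      (fun v hv k c d => by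
        rw [pd_pseudoInner (hfd v hv c) (hfd v hv d), hf v hv, hf v hv]
        simp only [pseudoInner_sum_left, pseudoInner_sum_right, pseudoInner_smul_left,
          pseudoInner_smul_right])
      (fun v hv k c d => by rw [pd_const, frameCoeff_gram hη hμ])
      hu₀ (fun c d => by rw [hf0, hf0, hF.gram_elim]) hu c d
  -- The tangent part of the frame is closed because Hessians are symmetric, so it is the
  -- differential of some `r`.
  obtain ⟨r, hrs, hr⟩ := exists_potential_pi (κ := Fin p ⊕ Fin q) hU hUs
    (f := fun i => f (Sum.inl i)) (fun i => hfs _) (fun u hu i j => by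
      rw [hf u hu, hf u hu]
      simp only [Fintype.sum_sum_type, frameCoeff, hessian_symm hU (hs.1 _) hu i j])
  have hframe : ∀ u ∈ U, IsFrame η μ (fun i => pd i r u) (fun α => f (Sum.inr α) u) :=
    fun u hu => by
      simp only [hr u hu]
      refine ⟨fun i j => ?_, fun α i => ?_, fun α β => ?_⟩ <;> rw [hgram u hu] <;> rfl
  have hfirst : ∀ u ∈ U, firstForm r u = η := fun u hu => by
    ext i j
    exact (hframe u hu).tangent i j
  refine ⟨r, fun α => f (Sum.inr α), ⟨⟨hrs, fun α => hfs _,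
    fun u hu => (hframe u hu).linearIndependent hη.2 hμ.2,
    fun u hu => (hfirst u hu).symm ▸ hη.2, fun u hu => (hframe u hu).normal,
    fun u hu => (hframe u hu).gram, fun u hu α β i => ?_,
    fun u hu => riemann_eq_zero_of_const hU hfirst hu⟩, hfirst⟩, fun u hu α => ?_⟩
  · rw [torsion, hf u hu, pseudoInner_sum_left]
    simp only [pseudoInner_smul_left, hgram u hu, Fintype.sum_sum_type,
      frameCoeff, Matrix.fromBlocks_apply₁₂, Matrix.zero_apply, mul_zero, zero_mul,
      Finset.sum_const_zero, add_zero]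
  · ext i j
    simp only [secondForm, Matrix.of_apply]
    rw [pd_congr hU (fun v hv => hr v hv i) hu, hf u hu, ← hμ.sum_inv_mul
      (fun β => hessian (ψ β) u i j) α]
    simp only [Fintype.sum_sum_type, frameCoeff, zero_smul, Finset.sum_const_zero, zero_add,
      pseudoInner_sum_right, pseudoInner_smul_right, hgram u hu, Matrix.fromBlocks_apply₂₂,
      hμ.1.apply _ α]

end Reconstruction

/-! ### A flat metric is the pullback of a constant one. -/

section FlatMetric

variable {N : ℕ} {U : Set (Fin N → ℝ)} {u : Fin N → ℝ}

theorem contDiffOn_det {A : (Fin N → ℝ) → Matrix (Fin N) (Fin N) ℝ}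
    (hA : ∀ i j, ContDiffOn ℝ ∞ (fun v => A v i j) U) : ContDiffOn ℝ ∞ (fun v => (A v).det) U := by
  simp only [Matrix.det_apply]
  exact ContDiffOn.sum fun σ _ => (contDiffOn_prod fun i _ => hA (σ i) i).const_smul _

theorem contDiffOn_matrix_inv {A : (Fin N → ℝ) → Matrix (Fin N) (Fin N) ℝ}
    (hA : ∀ i j, ContDiffOn ℝ ∞ (fun v => A v i j) U) (hdet : ∀ v ∈ U, (A v).det ≠ 0)
    (i j : Fin N) : ContDiffOn ℝ ∞ (fun v => (A v)⁻¹ i j) U := by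
  simp only [Matrix.inv_def, Ring.inverse_eq_inv', Matrix.smul_apply, Matrix.adjugate_apply,
    smul_eq_mul]
  refine ((contDiffOn_det hA).inv hdet).mul (contDiffOn_det fun k l => ?_)
  simp only [Matrix.updateRow_apply]
  split_ifs
  · exact contDiffOn_const
  · exact hA k l

variable {g : (Fin N → ℝ) → Matrix (Fin N) (Fin N) ℝ}

theorem contDiffOn_christoffel (hU : IsOpen U) (hgs : ∀ i j, ContDiffOn ℝ ∞ (fun v => g v i j) U)
    (hg : ∀ v ∈ U, IsMetric (g v)) (k i j : Fin N) : ContDiffOn ℝ ∞ (christoffel g k i j) U := by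
  refine contDiffOn_const.mul (ContDiffOn.sum fun s _ =>
    (contDiffOn_matrix_inv hgs (fun v hv => (hg v hv).2) k s).mul
      (((contDiffOn_pd hU (hgs j s) i).add (contDiffOn_pd hU (hgs i s) j)).sub
        (contDiffOn_pd hU (hgs i j) s)))

theorem pd_metric_symm (hU : IsOpen U) (hg : ∀ v ∈ U, IsMetric (g v)) (hu : u ∈ U) (i j k : Fin N) :
    pd k (fun v => g v i j) u = pd k (fun v => g v j i) u :=
  pd_congr hU (fun v hv => (hg v hv).1.apply j i) hu

theorem christoffel_symm (hU : IsOpen U) (hg : ∀ v ∈ U, IsMetric (g v)) (hu : u ∈ U)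
    (k i j : Fin N) : christoffel g k i j u = christoffel g k j i u := by
  simp only [christoffel, pd_metric_symm hU hg hu j i]
  congr 1
  exact Finset.sum_congr rfl fun s _ => by ring

theorem sum_christoffel_mul (hg : ∀ v ∈ U, IsMetric (g v)) (hu : u ∈ U) (i j k : Fin N) :
    ∑ m, christoffel g m k i u * g u m j = (1 / 2 : ℝ) * (pd k (fun v => g v i j) u +
      pd i (fun v => g v k j) u - pd j (fun v => g v k i) u) := by
  simp only [christoffel, mul_assoc, ← Finset.mul_sum]
  congr 1
  exact (hg u hu).sum_inv_mul (fun s => pd k (fun v => g v i s) u +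
      pd i (fun v => g v k s) u - pd s (fun v => g v k i) u) j

/-- Metric compatibility of the Levi-Civita connection, in the form that `g` solves the bilinear
system with coefficients `Γ`. -/
theorem pd_metric (hU : IsOpen U) (hg : ∀ v ∈ U, IsMetric (g v)) (hu : u ∈ U) (i j k : Fin N) :
    pd k (fun v => g v i j) u = ∑ m, christoffel g m k i u * g u m j +
      ∑ m, christoffel g m k j u * g u i m := by
  simp only [fun m => ((hg u hu).1.apply m i : g u i m = g u m i)]
  rw [sum_christoffel_mul hg hu, sum_christoffel_mul hg hu, pd_metric_symm hU hg hu j i,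
    pd_metric_symm hU hg hu k j, pd_metric_symm hU hg hu k i]
  ring

/-- If the fields `θ^a` solve a linear system, the bilinear form `M(θ, θ)` solves the induced
one. -/
theorem pd_congruence_sum {ι : Type} [Fintype ι] {Γ : ι → ι → ℝ} {k : Fin N} (M : ι → ι → ℝ)
    {θ : ι → ι → (Fin N → ℝ) → ℝ} (hd : ∀ a i, DifferentiableAt ℝ (θ a i) u)
    (hθ : ∀ a c, pd k (θ a c) u = ∑ d, Γ c d * θ a d u) (i j : ι) :
    pd k (fun v => ∑ a, ∑ b, M a b * (θ a i v * θ b j v)) u =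
      ∑ e, Γ i e * (∑ a, ∑ b, M a b * (θ a e u * θ b j u)) +
        ∑ e, Γ j e * (∑ a, ∑ b, M a b * (θ a i u * θ b e u)) := by
  have hd' : ∀ a b, DifferentiableAt ℝ (fun v => θ a i v * θ b j v) u := fun a b =>
    (hd a i).mul (hd b j)
  rw [pd_sum fun a _ => DifferentiableAt.fun_sum fun b _ => (hd' a b).const_mul _]
  simp only [Finset.mul_sum]
  rw [Finset.sum_comm, ← Finset.sum_comm (γ := ι) (s := Finset.univ) (t := Finset.univ)
    (f := fun a e => ∑ b, Γ j e * (M a b * (θ a i u * θ b e u))), ← Finset.sum_add_distrib]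
  refine Finset.sum_congr rfl fun a _ => ?_
  rw [pd_sum fun b _ => (hd' a b).const_mul _, Finset.sum_comm,
    ← Finset.sum_comm (γ := ι) (s := Finset.univ) (t := Finset.univ)
    (f := fun b e => Γ j e * (M a b * (θ a i u * θ b e u))), ← Finset.sum_add_distrib]
  refine Finset.sum_congr rfl fun b _ => ?_
  rw [pd_const_mul _ (hd' a b), pd_mul (hd a i) (hd b j), hθ, hθ, Finset.sum_mul, Finset.mul_sum,
    ← Finset.sum_add_distrib, ← Finset.sum_add_distrib, Finset.mul_sum]
  exact Finset.sum_congr rfl fun e _ => by ring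

/-- The Jacobian matrix `(∂fᵃ/∂uⁱ)`. -/
noncomputable def jacobian (f : (Fin N → ℝ) → Fin N → ℝ) (u : Fin N → ℝ) :
    Matrix (Fin N) (Fin N) ℝ :=
  LinearMap.toMatrix' (fderiv ℝ f u : (Fin N → ℝ) →ₗ[ℝ] Fin N → ℝ)

theorem jacobian_apply (f : (Fin N → ℝ) → Fin N → ℝ) (u : Fin N → ℝ) (a i : Fin N) :
    jacobian f u a i = pd i f u a := by
  simp [jacobian, LinearMap.toMatrix'_apply, pd, Pi.single]

/-- The rows of the Jacobian form a parallel coframe `θ`, equal to the identity at `u₀`. Zero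
curvature is the integrability condition for `θ`, and symmetry of `Γ` makes each `θ a` closed, hence
some `dV a`. Both `g` and the form `g u₀` evaluated on `θ` solve the bilinear system of `Γ` and
agree at `u₀`. -/
theorem exists_flat_map (hU : IsOpen U) (hUs : IsSimplyConnected U)
    (hgs : ∀ i j, ContDiffOn ℝ ∞ (fun v => g v i j) U) (hg : ∀ v ∈ U, IsMetric (g v))
    (hflat : ∀ v ∈ U, ∀ l k i j, riemann g l k i j v = 0) {u₀ : Fin N → ℝ} (hu₀ : u₀ ∈ U) :
    ∃ V : (Fin N → ℝ) → Fin N → ℝ, ContDiffOn ℝ ∞ V U ∧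
      ∀ u ∈ U, g u = (jacobian V u).transpose * g u₀ * jacobian V u := by
  have hΓ : ∀ k c d, ContDiffOn ℝ ∞ (christoffel g d k c) U := fun k c d =>
    contDiffOn_christoffel hU hgs hg d k c
  have hcompat : ∀ u ∈ U, ∀ k l c d, pd l (christoffel g d k c) u +
      ∑ e, christoffel g e k c u * christoffel g d l e u = pd k (christoffel g d l c) u +
      ∑ e, christoffel g e l c u * christoffel g d k e u := fun u hu k l c d => by
    have h := hflat u hu d c l k
    rw [riemann, Finset.sum_sub_distrib] at h
    simp only [mul_comm (christoffel g _ k c u), mul_comm (christoffel g _ l c u)]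
    linarith
  have hθ : ∀ a : Fin N, ∃ Y : Fin N → (Fin N → ℝ) → ℝ, (∀ c, ContDiffOn ℝ ∞ (Y c) U) ∧
      (∀ c, Y c u₀ = if a = c then 1 else 0) ∧
      ∀ u ∈ U, ∀ i c, pd i (Y c) u = ∑ d, christoffel g d i c u * Y d u := fun a =>
    exists_linear_system_solution hU hUs (a := fun k c d => christoffel g d k c) hΓ hcompat hu₀ _
  choose θ hθs hθ0 hθ using hθ
  have hV : ∀ a, ∃ ψ : (Fin N → ℝ) → ℝ, ContDiffOn ℝ ∞ ψ U ∧
      ∀ u ∈ U, ∀ i, pd i ψ u = θ a i u := fun a =>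
    exists_potential hU hUs (hθs a) fun u hu i j => by
      rw [hθ a u hu, hθ a u hu]
      exact Finset.sum_congr rfl fun d _ => by rw [christoffel_symm hU hg hu]
  choose V hVs hV using hV
  have hVs' : ContDiffOn ℝ ∞ (fun v a => V a v) U := contDiffOn_pi.2 hVs
  have hθd : ∀ u ∈ U, ∀ a i, DifferentiableAt ℝ (θ a i) u := fun u hu a i =>
    differentiableAt_of_contDiffOn hU (hθs a i) hu
  have hS : ∀ u ∈ U, ∀ i j, g u i j = ∑ a, ∑ b, g u₀ a b * (θ a i u * θ b j u) :=
    fun u hu i j => bilinear_system_solution_unique hU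
      hUs.isPathConnected.isConnected.isPreconnected
      (a := fun k c d => christoffel g d k c) hΓ (S := fun i j v => g v i j)
      (S' := fun i j v => ∑ a, ∑ b, g u₀ a b * (θ a i v * θ b j v)) hgs
      (fun i j => ContDiffOn.sum fun a _ => ContDiffOn.sum fun b _ =>
        contDiffOn_const.mul ((hθs a i).mul (hθs b j)))
      (fun u hu k i j => pd_metric hU hg hu i j k)
      (fun u hu k i j => pd_congruence_sum _ (hθd u hu) (fun a => hθ a u hu k) i j)
      hu₀ (fun i j => by simp [hθ0]) hu i j
  refine ⟨fun v a => V a v, hVs', fun u hu => ?_⟩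
  have hJ : ∀ a i, jacobian (fun v a => V a v) u a i = θ a i u := fun a i => by
    rw [jacobian_apply, pd_apply (differentiableAt_of_contDiffOn hU hVs' hu), hV a u hu]
  ext i j
  rw [hS u hu]
  simp only [Matrix.mul_apply, Matrix.transpose_apply, hJ, Finset.sum_mul]
  rw [Finset.sum_comm]
  exact Finset.sum_congr rfl fun b _ => Finset.sum_congr rfl fun a _ => by ring

end FlatMetric

/-! ### Change of coordinates, and flat coordinates near a point. -/

section CoordinateChange

variable {N L p q : ℕ} {U W : Set (Fin N → ℝ)} {v : Fin N → ℝ} {e : (Fin N → ℝ) → Fin N → ℝ}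

theorem pd_comp {E : Type} [NormedAddCommGroup E] [NormedSpace ℝ E] {f : (Fin N → ℝ) → E}
    (hf : DifferentiableAt ℝ f (e v)) (he : DifferentiableAt ℝ e v) (i : Fin N) :
    pd i (f ∘ e) v = ∑ j, jacobian e v j i • pd j f (e v) := by
  simp only [jacobian_apply]
  rw [← fderiv_eq_sum_pd, pd, fderiv_comp v hf he]
  rfl

theorem jacobian_comp {f : (Fin N → ℝ) → Fin N → ℝ} (hf : DifferentiableAt ℝ f (e v))
    (he : DifferentiableAt ℝ e v) : jacobian (f ∘ e) v = jacobian f (e v) * jacobian e v := by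
  simp only [jacobian]
  rw [fderiv_comp v hf he, ← LinearMap.toMatrix'_comp]
  rfl

theorem firstForm_comp {r : (Fin N → ℝ) → PseudoE p q} (hr : DifferentiableAt ℝ r (e v))
    (he : DifferentiableAt ℝ e v) :
    firstForm (r ∘ e) v = (jacobian e v).transpose * firstForm r (e v) * jacobian e v := by
  ext i j
  simp only [firstForm, Matrix.of_apply, pd_comp hr he, pseudoInner_sum_left,
    pseudoInner_sum_right, pseudoInner_smul_left, pseudoInner_smul_right, Matrix.mul_apply,
    Matrix.transpose_apply, Finset.sum_mul, Finset.mul_sum]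
  exact Finset.sum_congr rfl fun b _ => Finset.sum_congr rfl fun a _ => by ring

/-- No transformation law for curvature is needed: the new first form is constant, so its curvature
vanishes, and independence of the new frame follows from its Gram matrix. -/
theorem IsFlatTorsionless.comp {μ : Matrix (Fin L) (Fin L) ℝ} {η : Matrix (Fin N) (Fin N) ℝ}
    {r : (Fin N → ℝ) → PseudoE p q} {n : Fin L → (Fin N → ℝ) → PseudoE p q}
    (h : IsFlatTorsionless U μ r n) (hU : IsOpen U) (hW : IsOpen W) (he : ContDiffOn ℝ ∞ e W)
    (hWU : MapsTo e W U) (hη : η.det ≠ 0) (hμ : μ.det ≠ 0)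
    (hI : ∀ v ∈ W, firstForm (r ∘ e) v = η) :
    IsFlatTorsionlessIn W η μ (r ∘ e) (fun α => n α ∘ e) := by
  have hed : ∀ v ∈ W, DifferentiableAt ℝ e v := fun v hv => differentiableAt_of_contDiffOn hW he hv
  have hrd : ∀ v ∈ W, DifferentiableAt ℝ r (e v) := fun v hv =>
    differentiableAt_of_contDiffOn hU h.smooth_r (hWU hv)
  have hnd : ∀ v ∈ W, ∀ α, DifferentiableAt ℝ (n α) (e v) := fun v hv α =>
    differentiableAt_of_contDiffOn hU (h.smooth_n α) (hWU hv)
  have hF : ∀ v ∈ W, IsFrame η μ (fun i => pd i (r ∘ e) v) (fun α => n α (e v)) := fun v hv => by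
    refine ⟨fun i j => by rw [← hI v hv]; rfl, fun α i => ?_, h.gram _ (hWU hv)⟩
    rw [pd_comp (hrd v hv) (hed v hv)]
    simp [pseudoInner_sum_right, pseudoInner_smul_right, h.normal _ (hWU hv)]
  refine ⟨⟨h.smooth_r.comp he hWU, fun α => (h.smooth_n α).comp he hWU,
    fun v hv => (hF v hv).linearIndependent hη hμ, fun v hv => (hI v hv).symm ▸ hη,
    fun v hv => (hF v hv).normal, fun v hv => (hF v hv).gram, fun v hv α β i => ?_,
    fun v hv => riemann_eq_zero_of_const hW hI hv⟩, hI⟩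
  have ht : ∀ i, pseudoInner (pd i (n α) (e v)) (n β (e v)) = 0 := fun i =>
    h.torsionless _ (hWU hv) α β i
  simp only [torsion, pd_comp (hnd v hv α) (hed v hv), pseudoInner_sum_left,
    pseudoInner_smul_left, Function.comp_apply, ht, mul_zero, Finset.sum_const_zero]

theorem isSimplyConnected_ball (x : Fin N → ℝ) {ε : ℝ} (hε : 0 < ε) :
    IsSimplyConnected (ball x ε) := by
  have := (convex_ball x ε).contractibleSpace (nonempty_ball.2 hε)
  exact SimplyConnectedSpace.ofContractible _

/-- A smooth map with invertible Jacobian restricts to a diffeomorphism onto a ball. -/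
theorem exists_local_diffeomorph {V : (Fin N → ℝ) → Fin N → ℝ} (hU : IsOpen U)
    (hV : ContDiffOn ℝ ∞ V U) (hdet : ∀ u ∈ U, (jacobian V u).det ≠ 0) {u₀ : Fin N → ℝ}
    (hu₀ : u₀ ∈ U) :
    ∃ φ : OpenPartialHomeomorph (Fin N → ℝ) (Fin N → ℝ), ⇑φ.symm = V ∧
      IsSimplyConnected φ.source ∧ φ.target ⊆ U ∧ u₀ ∈ φ.target ∧ ContDiffOn ℝ ∞ φ φ.source := by
  have hdet' : ∀ u ∈ U, (fderiv ℝ V u).det ≠ 0 := fun u hu => by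
    rw [ContinuousLinearMap.det, ← LinearMap.det_toMatrix']
    exact hdet u hu
  have hder : ∀ u (hu : u ∈ U), HasFDerivAt V (((fderiv ℝ V u).toContinuousLinearEquivOfDetNeZero
      (hdet' u hu) : (Fin N → ℝ) ≃L[ℝ] (Fin N → ℝ)) : (Fin N → ℝ) →L[ℝ] (Fin N → ℝ)) u :=
    fun u hu => by
      rw [ContinuousLinearMap.coe_toContinuousLinearEquivOfDetNeZero]
      exact (differentiableAt_of_contDiffOn hU hV hu).hasFDerivAt
  have hVa : ∀ u ∈ U, ContDiffAt ℝ ∞ V u := fun u hu => hV.contDiffAt (hU.mem_nhds hu)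
  have hn : (∞ : WithTop ℕ∞) ≠ 0 := by simp
  let φ := ((hVa u₀ hu₀).toOpenPartialHomeomorph V (hder u₀ hu₀) hn).restrOpen U hU
  have hφ : ⇑φ = V := rfl
  have hφU : φ.source ⊆ U := inter_subset_right
  have hu₀φ : u₀ ∈ φ.source :=
    ⟨(hVa u₀ hu₀).mem_toOpenPartialHomeomorph_source (hder u₀ hu₀) hn, hu₀⟩
  obtain ⟨ε, hε, hball⟩ := Metric.isOpen_iff.1 φ.open_target (V u₀) (φ.map_source hu₀φ)
  -- The chart is the local inverse of `V`, cut down to a ball of flat coordinates so that its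
  -- source is simply connected.
  let ψ := φ.symm.restrOpen (ball (V u₀) ε) isOpen_ball
  have hsource : ψ.source = ball (V u₀) ε := inter_eq_right.2 hball
  have htarget : ψ.target ⊆ φ.source := fun u hu => by
    have := ψ.map_target hu
    rw [hsource] at this
    rw [← ψ.right_inv hu]
    exact φ.map_target (hball this)
  refine ⟨ψ, rfl, ?_, htarget.trans hφU, ?_, fun v hv => ?_⟩
  · rw [hsource]
    exact isSimplyConnected_ball _ hε
  · have h1 : V u₀ ∈ ψ.source := hsource ▸ mem_ball_self hε
    have := ψ.map_source h1
    rwa [show ψ (V u₀) = u₀ from φ.left_inv hu₀φ] at this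
  · rw [hsource] at hv
    have hvU : φ.symm v ∈ U := hφU (φ.map_target (hball hv))
    exact (φ.contDiffAt_symm (hball hv) (hder _ hvU) (hVa _ hvU)).contDiffWithinAt

theorem IsFlatTorsionless.exists_flat_coordinates {μ : Matrix (Fin L) (Fin L) ℝ}
    {r : (Fin N → ℝ) → PseudoE p q} {n : Fin L → (Fin N → ℝ) → PseudoE p q}
    (h : IsFlatTorsionless U μ r n) (hpq : p + q = N + L) (hU : IsOpen U) {u₀ : Fin N → ℝ}
    (hu₀ : u₀ ∈ U) :
    ∃ (η : Matrix (Fin N) (Fin N) ℝ) (e : OpenPartialHomeomorph (Fin N → ℝ) (Fin N → ℝ)),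
      IsSimplyConnected e.source ∧ e.target ⊆ U ∧ u₀ ∈ e.target ∧
      ContDiffOn ℝ ∞ e e.source ∧ ContDiffOn ℝ ∞ e.symm e.target ∧
      IsFlatTorsionlessIn e.source η μ (r ∘ e) (fun α => n α ∘ e) := by
  obtain ⟨ε, hε, hball⟩ := Metric.isOpen_iff.1 hU u₀ hu₀
  have hB : IsSimplyConnected (ball u₀ ε) := isSimplyConnected_ball _ hε
  have hu₀B : u₀ ∈ ball u₀ ε := mem_ball_self hε
  have hmetric : ∀ v ∈ U, IsMetric (firstForm r v) := fun v hv => (h.isMetric hpq hv).1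
  have hμ := (h.isMetric hpq hu₀).2
  obtain ⟨V, hVs, hV⟩ := exists_flat_map (g := firstForm r) isOpen_ball hB
    (fun i j => (contDiffOn_pseudoInner (contDiffOn_pd hU h.smooth_r i)
      (contDiffOn_pd hU h.smooth_r j)).mono hball)
    (fun v hv => hmetric v (hball hv)) (fun v hv => h.flat v (hball hv)) hu₀B
  -- The Jacobian of `V` is invertible because the nondegenerate metric is `Jᵀ g(u₀) J`. Composition
  -- with the inverse of `V` undoes `J` and leaves the constant `g(u₀)`.
  obtain ⟨e, heV, hes, het, heu, he⟩ := exists_local_diffeomorph isOpen_ball hVs (fun u hu h0 => by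
    have := (hmetric u (hball hu)).2
    rw [hV u hu, Matrix.det_mul, h0, mul_zero] at this
    exact this rfl) hu₀B
  have hmaps : MapsTo e e.source (ball u₀ ε) := fun v hv => het (e.map_source hv)
  refine ⟨firstForm r u₀, e, hes, het.trans hball, heu, he, heV ▸ hVs.mono het,
    h.comp hU e.open_source he (hmaps.mono_right hball) (hmetric u₀ hu₀).2 hμ.2 fun v hv => ?_⟩
  have hed : DifferentiableAt ℝ e v := differentiableAt_of_contDiffOn e.open_source he hv
  have hVd : DifferentiableAt ℝ V (e v) :=
    differentiableAt_of_contDiffOn isOpen_ball hVs (hmaps hv)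
  have hJ : jacobian V (e v) * jacobian e v = 1 := by
    rw [← jacobian_comp hVd hed]
    have : V ∘ e =ᶠ[𝓝 v] id := eventually_of_mem (e.open_source.mem_nhds hv) fun w hw => by
      simpa [heV] using e.left_inv hw
    rw [jacobian, this.fderiv_eq, fderiv_id]
    exact LinearMap.toMatrix'_id
  rw [firstForm_comp (differentiableAt_of_contDiffOn hU h.smooth_r (hball (hmaps hv))) hed,
    hV _ (hmaps hv)]
  calc _ = (jacobian V (e v) * jacobian e v).transpose * firstForm r u₀ *
        (jacobian V (e v) * jacobian e v) := by
        simp only [Matrix.transpose_mul, Matrix.mul_assoc]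
    _ = _ := by simp [hJ]

end CoordinateChange

end Submfd

theorem theorem1 (N L p q : ℕ) (hpq : p + q = N + L) :
    -- a flat torsionless submanifold admits flat coordinates near each of its points
    (∀ (U : Set (Fin N → ℝ)) (μ : Matrix (Fin L) (Fin L) ℝ)
        (r : (Fin N → ℝ) → Submfd.PseudoE p q) (n : Fin L → (Fin N → ℝ) → Submfd.PseudoE p q),
      IsOpen U → Submfd.IsFlatTorsionless U μ r n → ∀ u₀ ∈ U,
      ∃ (η : Matrix (Fin N) (Fin N) ℝ) (e : OpenPartialHomeomorph (Fin N → ℝ) (Fin N → ℝ)),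
        IsSimplyConnected e.source ∧ e.target ⊆ U ∧ u₀ ∈ e.target ∧
        ContDiffOn ℝ ∞ e e.source ∧ ContDiffOn ℝ ∞ e.symm e.target ∧
        Submfd.IsFlatTorsionlessIn e.source η μ (r ∘ e) (fun α => n α ∘ e)) ∧
    -- in any flat coordinates, it gives a solution, unique up to affine functions
    (∀ (U : Set (Fin N → ℝ)) (η : Matrix (Fin N) (Fin N) ℝ) (μ : Matrix (Fin L) (Fin L) ℝ)
        (r : (Fin N → ℝ) → Submfd.PseudoE p q) (n : Fin L → (Fin N → ℝ) → Submfd.PseudoE p q),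
      IsOpen U → IsSimplyConnected U → Submfd.IsFlatTorsionlessIn U η μ r n →
      Submfd.IsMetric η ∧ Submfd.IsMetric μ ∧ Submfd.SignatureSum p q η μ ∧
      ∃ ψ : Fin L → (Fin N → ℝ) → ℝ,
        Submfd.IsSolution U η μ ψ ∧ Submfd.HasHessianForms U r n ψ ∧
        ∀ ψ' : Fin L → (Fin N → ℝ) → ℝ,
          (Submfd.IsSolution U η μ ψ' ∧ Submfd.HasHessianForms U r n ψ') ↔
            ∃ (a : Fin L → Fin N → ℝ) (c : Fin L → ℝ),
              ∀ u ∈ U, ∀ α, ψ' α u = ψ α u + ∑ i, a α i * u i + c α) ∧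
    -- each solution gives a flat torsionless submanifold, unique up to motions
    (∀ (U : Set (Fin N → ℝ)) (η : Matrix (Fin N) (Fin N) ℝ) (μ : Matrix (Fin L) (Fin L) ℝ)
        (ψ : Fin L → (Fin N → ℝ) → ℝ),
      IsOpen U → IsSimplyConnected U → Submfd.IsMetric η → Submfd.IsMetric μ →
      Submfd.SignatureSum p q η μ → Submfd.IsSolution U η μ ψ →
      ∃ (r : (Fin N → ℝ) → Submfd.PseudoE p q) (n : Fin L → (Fin N → ℝ) → Submfd.PseudoE p q),
        Submfd.IsFlatTorsionlessIn U η μ r n ∧ Submfd.HasHessianForms U r n ψ ∧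
        ∀ (r' : (Fin N → ℝ) → Submfd.PseudoE p q) (n' : Fin L → (Fin N → ℝ) → Submfd.PseudoE p q),
          Submfd.IsFlatTorsionlessIn U η μ r' n' → Submfd.HasHessianForms U r' n' ψ →
          Submfd.Congruent U r r' n n') := by
  refine ⟨fun U μ r n hU h u₀ hu₀ => h.exists_flat_coordinates hpq hU hu₀,
    fun U η μ r n hU hUs h => Submfd.exists_solution_of_isFlatTorsionlessIn hpq hU hUs h,
    fun U η μ ψ hU hUs hη hμ hsig hs => ?_⟩
  obtain ⟨r, n, h, hH⟩ := Submfd.exists_isFlatTorsionlessIn hU hUs hη hμ hsig hs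
  exact ⟨r, n, h, hH, fun r' n' h' hH' => Submfd.congruent_of_hasHessianForms hpq hU
    hUs.isPathConnected.isConnected hs.1 h hH h' hH'⟩
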